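/- Let $K$ be a field, let $m,n,t$ be integers with $1\le t\le \min(m,n)$, and let $X=(X_{ij})$ be an $m\times n$ matrix of indeterminates over $K$. For $s\ge 0$ let $I_s=I_s(X)$ be the ideal of the polynomial ring $K[X]=K[X_{ij}: 1\le i\le m,\ 1\le j\le n]$ generated by all $s$-minors of $X$, i.e. the determinants of the $s\times s$ submatrices of $X$; the empty minor is $1$, so that $I_0=K[X]$. Then the ring $R=K[X]/I_t$ is a normal domain (an integral domain that is integrally closed in its field of fractions) of Krull dimension $(m+n-t+1)(t-1)$. Its singular locus, i.e. the set of all prime ideals $\mathfrak p$ of $R$ such that the local ring $R_{\mathfrak p}$ is not regular, is $V(I_{t-1}/I_t)$, the set of all prime ideals of $R$ containing $I_{t-1}/I_t$. -/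

import Mathlib

/-- The polynomial ring `K[X]` in the entries of an `m × n` matrix of indeterminates. -/
abbrev GenericRing (K : Type*) [Field K] (m n : ℕ) : Type _ :=
  MvPolynomial (Fin m × Fin n) K

/-- The `t`-th determinantal ideal `I_t(X)` of the generic `m × n` matrix `X = (X_ij)`: the ideal
generated by all `t`-minors `[a_1 … a_t | b_1 … b_t]`, with `a_1 < … < a_t` and `b_1 < … < b_t`.
For `t = 0` the only generator is the empty minor `1`, so this is the unit ideal. -/
noncomputable def determinantalIdeal (K : Type*) [Field K] (m n t : ℕ) :
    Ideal (GenericRing K m n) :=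
  Ideal.span {δ | ∃ (a : Fin t ↪o Fin m) (b : Fin t ↪o Fin n),
    δ = ((Matrix.mvPolynomialX (Fin m) (Fin n) K).submatrix a b).det}

/-- The determinantal ring `K[X]/I_t(X)`. -/
abbrev DeterminantalRing (K : Type*) [Field K] (m n t : ℕ) : Type _ :=
  GenericRing K m n ⧸ determinantalIdeal K m n t

/-- The singular locus of a commutative ring `R`: the set of the prime ideals `p` of `R` for which
the localization `R_p` is not a regular local ring. -/
def singularLocus (R : Type*) [CommRing R] : Set (PrimeSpectrum R) :=
  {p | ¬ IsRegularLocalRing (Localization.AtPrime p.asIdeal)}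

/-! Primality is proved by filling in the matrix one entry at a time, row by row. A ladder ideal
bounds, for each `l`, the rank of the first `l` columns in the rows filled so far; with the bounds
`min l (t - 1)` and complete rows it is `I_t`. When the entry Y at (p, q) enters, the ideal either
does not change, or gains Y, or has the form I = N + (q_i Y + r_i), where N extends to the previous
ideal and q_i, r_i are minors free of Y. Then J = N + (q_i) is again a ladder ideal, for a shorter
ladder and a truncated rank function (`ladderIdeal_truncateRank`). A matrix of known rank with one
hole has a forced completion (`exists_rank_completion`), so over the fraction field modulo N the
polynomials q_i Y + r_i share a root y, and I/N = (J/N)[Y] · (Y - y). From this factorization I is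
prime (`isPrime_linearExtension`), and I + (x) is radical if N + (x) and J + (x) are
(`isRadical_linearExtension_sup`); here x is the top right entry of the matrix.

The other statements rest on the Schur complement. Once an r-minor δ is invertible, X is the sum of
a matrix of rank r, determined by the rows and columns of δ, and a matrix Y supported away from
them; X has vanishing (r + s)-minors exactly when Y has vanishing s-minors. So inverting δ gives a
smaller determinantal ring over a localized polynomial ring (`minorLocalizationEquiv`). For δ = x
this makes the localization normal by induction, and normality descends because x generates a
radical ideal. For r = t - 1 the localization is a localized polynomial ring, which gives the
dimension through the transcendence degree, and regularity off V(I_{t-1}). At a prime containing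
I_{t-1} the t-minors lie in the square of the maximal ideal of the local ring of K[X], so the
quotient keeps the embedding dimension while the dimension drops. -/

/-! ### Ideals generated by polynomials linear in one variable. -/

section VertexDecomposition

open Polynomial

variable {A : Type*} [CommRing A] {F : Type*} [Field F] {κ : Type*}

/-- The ideal of `A[Y]` generated by `N` and the linear polynomials `q i * Y + r i`. -/
noncomputable def linearExtension (N : Ideal A) (q r : κ → A) : Ideal A[X] :=
  N.map C ⊔ Ideal.span (Set.range fun i => X * C (q i) + C (r i))

variable {N J : Ideal A} {q r : κ → A} {π : A →+* F} {y : F}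

theorem map_eq_zero_iff_mem_map_C (hker : RingHom.ker π = N) (f : A[X]) :
    f.map π = 0 ↔ f ∈ N.map C := by
  rw [Ideal.mem_map_C_iff, Polynomial.ext_iff]
  simp [← hker, RingHom.mem_ker]

theorem exists_mem_linearExtension_of_mem_map_C (hker : RingHom.ker π = N)
    (hJ : J = N ⊔ Ideal.span (Set.range q)) (hy : ∀ i, y * π (q i) + π (r i) = 0)
    {g : A[X]} (hg : g ∈ J.map C) :
    ∃ f ∈ linearExtension N q r, f.map π = g.map π * (X - C y) := by
  rw [hJ, Ideal.map_sup, Ideal.map_span, ← Set.range_comp] at hg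
  obtain ⟨n, hn, g', hg', rfl⟩ := Submodule.mem_sup.mp hg
  have hn0 : n.map π = 0 := (map_eq_zero_iff_mem_map_C hker n).mpr hn
  simp only [Polynomial.map_add, hn0, zero_add]
  clear hg hn hn0
  induction hg' using Submodule.span_induction with
  | mem x hx =>
    obtain ⟨i, rfl⟩ := hx
    refine ⟨X * C (q i) + C (r i), Ideal.mem_sup_right (Ideal.subset_span ⟨i, rfl⟩), ?_⟩
    have : π (r i) = - (y * π (q i)) := by linear_combination hy i
    simp [this]; ring
  | zero => exact ⟨0, zero_mem _, by simp⟩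
  | add f g _ _ hf hg =>
    obtain ⟨f', hf', hf⟩ := hf
    obtain ⟨g', hg', hg⟩ := hg
    exact ⟨f' + g', add_mem hf' hg', by simp [hf, hg, add_mul]⟩
  | smul a f _ hf =>
    obtain ⟨f', hf', hf⟩ := hf
    exact ⟨a * f', Ideal.mul_mem_left _ _ hf', by simp [hf, mul_assoc]⟩

/-- In F[Y] each generator q_i Y + r_i becomes q_i (Y - y), so the image of the ideal is that of
J[Y] multiplied by Y - y; the kernel N[Y] is contained in the ideal. -/
theorem mem_linearExtension_iff (hker : RingHom.ker π = N)
    (hJ : J = N ⊔ Ideal.span (Set.range q)) (hy : ∀ i, y * π (q i) + π (r i) = 0) (f : A[X]) :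
    f ∈ linearExtension N q r ↔ ∃ g ∈ J.map C, f.map π = g.map π * (X - C y) := by
  constructor
  · intro hf
    obtain ⟨n, hn, f', hf', rfl⟩ := Submodule.mem_sup.mp hf
    have hn0 : n.map π = 0 := (map_eq_zero_iff_mem_map_C hker n).mpr hn
    simp only [Polynomial.map_add, hn0, zero_add]
    clear hf hn hn0
    induction hf' using Submodule.span_induction with
    | mem x hx =>
      obtain ⟨i, rfl⟩ := hx
      refine ⟨C (q i), Ideal.mem_map_of_mem _
        (hJ ▸ Ideal.mem_sup_right (Ideal.subset_span ⟨i, rfl⟩)), ?_⟩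
      have : π (r i) = - (y * π (q i)) := by linear_combination hy i
      simp [this]; ring
    | zero => exact ⟨0, zero_mem _, by simp⟩
    | add f g _ _ hf hg =>
      obtain ⟨f', hf', hf⟩ := hf
      obtain ⟨g', hg', hg⟩ := hg
      exact ⟨f' + g', add_mem hf' hg', by simp [hf, hg, add_mul]⟩
    | smul a f _ hf =>
      obtain ⟨f', hf', hf⟩ := hf
      exact ⟨a * f', Ideal.mul_mem_left _ _ hf', by simp [hf, mul_assoc]⟩
  · rintro ⟨g, hg, hfg⟩
    obtain ⟨f', hf', hfg'⟩ := exists_mem_linearExtension_of_mem_map_C hker hJ hy hg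
    have : f - f' ∈ N.map C := by
      rw [← map_eq_zero_iff_mem_map_C hker, Polynomial.map_sub, hfg, hfg', sub_self]
    have h1 : f - f' ∈ linearExtension N q r := Ideal.mem_sup_left this
    have h2 := add_mem h1 hf'
    simpa using h2

/-- Modulo `x ∉ J`, a polynomial of degree at most `e` in the ideal generated by a linear extension
and `x` is congruent to a product with `Y - y` whose cofactor has degree less than `e`. -/
theorem exists_cofactor_degree_lt (hker : RingHom.ker π = N)
    (hJ : J = N ⊔ Ideal.span (Set.range q)) (hJp : J.IsPrime)
    (hy : ∀ i, y * π (q i) + π (r i) = 0) {x : A} (hx : x ∉ J) {f : A[X]} {e : ℕ}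
    (hf : f.natDegree ≤ e) (d : ℕ) : ∀ g h : A[X], g ∈ J.map C → g.degree < (e + d : ℕ) →
      f.map π = g.map π * (X - C y) + C (π x) * h.map π →
      ∃ g' h' : A[X], g' ∈ J.map C ∧ g'.degree < e ∧
        f.map π = g'.map π * (X - C y) + C (π x) * h'.map π ∧ h - h' ∈ linearExtension N q r := by
  have hNJ : N ≤ J := hJ ▸ le_sup_left
  induction d with
  | zero => exact fun g h hg hd hfgh => ⟨g, h, hg, hd, hfgh, by simp⟩
  | succ d ih =>
    intro g h hg hd hfgh
    have hg0 : g.coeff (e + d + 1) = 0 := coeff_eq_zero_of_degree_lt hd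
    have hf0 : f.coeff (e + d + 1) = 0 := coeff_eq_zero_of_natDegree_lt (by omega)
    have hc := congrArg (fun u => Polynomial.coeff u (e + d + 1)) hfgh
    simp only [coeff_map, hf0, mul_sub, coeff_add, coeff_sub, coeff_mul_X, coeff_mul_C, hg0,
      coeff_C_mul, map_zero, zero_mul, sub_zero] at hc
    set c := h.coeff (e + d + 1) with hcdef
    -- The degree e + d + 1 exceeds that of f, so comparing coefficients there makes this sum vanish
    -- modulo N. Thus x c lies in J, and so does c, as J is prime.
    have hgc : g.coeff (e + d) + x * c ∈ N := by
      rw [← hker, RingHom.mem_ker, map_add, map_mul, hc]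
    have hgJ : g.coeff (e + d) ∈ J := Ideal.mem_map_C_iff.mp hg _
    have hcJ : c ∈ J := by
      have : x * c ∈ J := by simpa using sub_mem (hNJ hgc) hgJ
      exact (hJp.mem_or_mem this).resolve_left hx
    have hmJ : monomial (e + d) c ∈ J.map C := by
      rw [Ideal.mem_map_C_iff]
      intro k
      rw [coeff_monomial]
      split_ifs <;> simp [hcJ]
    obtain ⟨u, huI, hu⟩ := exists_mem_linearExtension_of_mem_map_C hker hJ hy hmJ
    -- Adding x c Y^(e+d) to the cofactor cancels its top coefficient modulo N, and is compensated
    -- by subtracting c Y^(e+d) (Y - y) from h. The latter lifts to `u` in the linear extension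
    -- because c is in J.
    set g₁ := (g + C x * monomial (e + d) c).erase (e + d) with hg₁
    have hmapg₁ : g₁.map π = g.map π + C (π x) * (monomial (e + d) c).map π := by
      have h1 : (monomial (e + d) ((g + C x * monomial (e + d) c).coeff (e + d))).map π = 0 := by
        rw [map_monomial]
        have : π ((g + C x * monomial (e + d) c).coeff (e + d)) = 0 := by
          simpa [← hker, RingHom.mem_ker] using hgc
        rw [this, map_zero]
      have h2 := congrArg (Polynomial.map π)
        (monomial_add_erase (g + C x * monomial (e + d) c) (e + d))
      rw [Polynomial.map_add, h1, zero_add] at h2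
      rw [hg₁, h2]; simp
    have hg₁J : g₁ ∈ J.map C := by
      have : g + C x * monomial (e + d) c ∈ J.map C := add_mem hg (Ideal.mul_mem_left _ _ hmJ)
      rw [Ideal.mem_map_C_iff] at this ⊢
      intro k
      rw [hg₁, coeff_erase]
      split_ifs <;> simp only [zero_mem, this k]
    have hg₁d : g₁.degree < (e + d : ℕ) := by
      rw [degree_lt_iff_coeff_zero]
      intro k hk
      rw [hg₁, coeff_erase]
      split_ifs with hke
      · rfl
      · have : e + d + 1 ≤ k := by omega
        simp [coeff_monomial, Ne.symm hke,
          coeff_eq_zero_of_degree_lt (hd.trans_le (by exact_mod_cast this))]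
    obtain ⟨g', h', hg', hd', hfg', hhh⟩ := ih g₁ (h - u) hg₁J hg₁d (by
      rw [hmapg₁, Polynomial.map_sub, hu, hfgh]; ring)
    refine ⟨g', h', hg', hd', hfg', ?_⟩
    have := add_mem hhh huI
    convert this using 1; ring

theorem exists_cofactor (hker : RingHom.ker π = N)
    (hJ : J = N ⊔ Ideal.span (Set.range q)) (hJp : J.IsPrime)
    (hy : ∀ i, y * π (q i) + π (r i) = 0) {x : A} (hx : x ∉ J) {f g h : A[X]} {e : ℕ}
    (hf : f.natDegree ≤ e) (hg : g ∈ J.map C)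
    (hfgh : f.map π = g.map π * (X - C y) + C (π x) * h.map π) :
    ∃ g' h' : A[X], g' ∈ J.map C ∧ g'.degree < e ∧
      f.map π = g'.map π * (X - C y) + C (π x) * h'.map π ∧ h - h' ∈ linearExtension N q r := by
  refine exists_cofactor_degree_lt hker hJ hJp hy hx hf (g.natDegree + 1) g h hg ?_ hfgh
  exact degree_le_natDegree.trans_lt (by exact_mod_cast by omega)

theorem exists_linear_mem_linearExtension (hJ : J = N ⊔ Ideal.span (Set.range q)) {c : A}
    (hc : c ∈ J) : ∃ b, X * C c + C b ∈ linearExtension N q r := by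
  rw [hJ] at hc
  obtain ⟨n, hn, c, hc', rfl⟩ := Submodule.mem_sup.mp hc
  clear hc
  suffices H : ∃ b, X * C c + C b ∈ linearExtension N q r by
    obtain ⟨b, hb⟩ := H
    have h1 : X * C n ∈ linearExtension N q r :=
      Ideal.mul_mem_left _ _ (Ideal.mem_sup_left (Ideal.mem_map_of_mem C hn))
    exact ⟨b, by convert add_mem h1 hb using 1; rw [C_add]; ring⟩
  induction hc' using Submodule.span_induction with
  | mem x hx =>
    obtain ⟨i, rfl⟩ := hx
    exact ⟨r i, Ideal.mem_sup_right (Ideal.subset_span ⟨i, rfl⟩)⟩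
  | zero => exact ⟨0, by simp⟩
  | add f g _ _ hf hg =>
    obtain ⟨b, hf⟩ := hf
    obtain ⟨b', hg⟩ := hg
    exact ⟨b + b', by convert add_mem hf hg using 1; simp only [C_add]; ring⟩
  | smul a f _ hf =>
    obtain ⟨b, hf⟩ := hf
    exact ⟨a * b, by
      convert Ideal.mul_mem_left _ (C a) hf using 1; simp only [smul_eq_mul, C_mul]; ring⟩

/-- Membership of x f amounts to 0 = -g (Y - y) + x f modulo N. Apply `exists_cofactor` to the zero
polynomial with e = 0: the new cofactor has degree below 0, so it vanishes, and f is congruent to an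
element of N[Y]. -/
theorem mem_linearExtension_of_mul_mem (hker : RingHom.ker π = N)
    (hJ : J = N ⊔ Ideal.span (Set.range q)) (hJp : J.IsPrime)
    (hy : ∀ i, y * π (q i) + π (r i) = 0) {x : A} (hx : x ∉ J) {f : A[X]}
    (hf : C x * f ∈ linearExtension N q r) : f ∈ linearExtension N q r := by
  obtain ⟨g, hg, hfg⟩ := (mem_linearExtension_iff hker hJ hy _).mp hf
  obtain ⟨g', h', -, hd, h0, hh⟩ := exists_cofactor hker hJ hJp hy hx (f := 0) (e := 0)
    (g := -g) (h := f) (by simp) (neg_mem hg) (by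
      rw [Polynomial.map_neg, neg_mul, ← hfg]; simp)
  have hg0 : g' = 0 := by
    simpa [Nat.WithBot.lt_zero_iff] using hd
  have hx0 : π x ≠ 0 := fun h => hx (hJ ▸ Ideal.mem_sup_left (hker ▸ h))
  have hh0 : h'.map π = 0 := by simpa [hg0, hx0] using h0.symm
  have := add_mem hh (Ideal.mem_sup_left ((map_eq_zero_iff_mem_map_C hker h').mp hh0))
  simpa using this

/-- The ideal is the kernel of evaluation at y. If h(y) = 0, then eliminating Y through q_i Y ≡ -r_i
gives q_i^d h ≡ c with c in N, so q_i^d h is in the ideal. Multiplying by (-Y)^d turns q_i^d into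
r_i^d, which is a nonzerodivisor modulo the ideal since r_i is not in J. -/
theorem isPrime_linearExtension (hker : RingHom.ker π = N)
    (hJ : J = N ⊔ Ideal.span (Set.range q)) (hJp : J.IsPrime)
    (hy : ∀ i, y * π (q i) + π (r i) = 0) {i : κ} (hi : r i ∉ J) :
    (linearExtension N q r).IsPrime := by
  have hle : linearExtension N q r ≤ RingHom.ker (eval₂RingHom π y) := by
    intro f hf
    obtain ⟨g, -, hfg⟩ := (mem_linearExtension_iff hker hJ hy _).mp hf
    rw [RingHom.mem_ker, coe_eval₂RingHom, ← eval_map, hfg]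
    simp
  have hgen : X * C (q i) + C (r i) ∈ linearExtension N q r :=
    Ideal.mem_sup_right (Ideal.subset_span ⟨i, rfl⟩)
  have hred : ∀ h : A[X], ∃ (d : ℕ) (c : A), C (q i) ^ d * h - C c ∈ linearExtension N q r := by
    intro h
    simp only [← Ideal.Quotient.eq_zero_iff_mem] at hgen ⊢
    set φ := Ideal.Quotient.mk (linearExtension N q r)
    have hgen' : φ X * φ (C (q i)) = - φ (C (r i)) := by
      rw [map_add, map_mul] at hgen
      linear_combination hgen
    induction h using Polynomial.induction_on' with
    | add f g hf hg =>
      obtain ⟨d, c, h1⟩ := hf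
      obtain ⟨d', c', h2⟩ := hg
      refine ⟨d + d', q i ^ d' * c + q i ^ d * c', ?_⟩
      simp only [map_sub, map_mul, map_pow, map_add] at h1 h2 ⊢
      linear_combination φ (C (q i)) ^ d' * h1 + φ (C (q i)) ^ d * h2
    | monomial n a =>
      refine ⟨n, a * (- r i) ^ n, ?_⟩
      rw [← C_mul_X_pow_eq_monomial]
      simp only [map_sub, map_mul, map_pow, map_neg]
      have := congrArg (· ^ n) hgen'
      simp only [mul_pow] at this
      linear_combination φ (C a) * this
  have : linearExtension N q r = RingHom.ker (eval₂RingHom π y) := by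
    refine le_antisymm hle fun h hh => ?_
    obtain ⟨d, c, hc⟩ := hred h
    have hcN : c ∈ N := by
      have h1 := hle hc
      rw [RingHom.mem_ker] at hh h1
      rw [map_sub, map_mul, hh, mul_zero, zero_sub, neg_eq_zero] at h1
      rw [← hker, RingHom.mem_ker]
      simpa using h1
    have hqh : C (q i) ^ d * h ∈ linearExtension N q r := by
      have := add_mem hc (Ideal.mem_sup_left (Ideal.mem_map_of_mem C hcN))
      simpa using this
    have hrh : C (r i ^ d) * h ∈ linearExtension N q r := by
      rw [← Ideal.Quotient.eq_zero_iff_mem] at hgen hqh ⊢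
      set φ := Ideal.Quotient.mk (linearExtension N q r)
      have hgen' : φ (C (r i)) = (- φ X) * φ (C (q i)) := by
        rw [map_add, map_mul] at hgen
        linear_combination hgen
      rw [C_pow, map_mul, map_pow, hgen', mul_pow]
      rw [map_mul, map_pow] at hqh
      linear_combination (-φ X) ^ d * hqh
    exact mem_linearExtension_of_mul_mem hker hJ hJp hy
      (fun h => hi (hJp.mem_of_pow_mem _ h)) hrh
  rw [this]
  exact RingHom.ker_isPrime _

/-- The degree bound on cofactors controls leading coefficients: for an element of degree at most e,
the coefficient in degree e lies in J + (x), and in N + (x) if e = 0. If a power of f is in the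
ideal, the leading coefficient of f is therefore in J + (x), and f can be lowered in degree by
subtracting an element of the ideal. -/
theorem isRadical_linearExtension_sup (hker : RingHom.ker π = N)
    (hJ : J = N ⊔ Ideal.span (Set.range q)) (hJp : J.IsPrime)
    (hy : ∀ i, y * π (q i) + π (r i) = 0) {x : A} (hx : x ∉ J)
    (hNx : (N ⊔ Ideal.span {x}).IsRadical) (hJx : (J ⊔ Ideal.span {x}).IsRadical) :
    (linearExtension N q r ⊔ Ideal.span {C x}).IsRadical := by
  have hNJ : N ≤ J := hJ ▸ le_sup_left
  have key : ∀ (f : A[X]) (e : ℕ), f.natDegree ≤ e →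
      f ∈ linearExtension N q r ⊔ Ideal.span {C x} →
      (e = 0 → f.coeff e ∈ N ⊔ Ideal.span {x}) ∧ f.coeff e ∈ J ⊔ Ideal.span {x} := by
    intro f e hfe hf
    obtain ⟨u, hu, v, hv, rfl⟩ := Submodule.mem_sup.mp hf
    obtain ⟨h, rfl⟩ := Ideal.mem_span_singleton'.mp hv
    obtain ⟨g, hg, hug⟩ := (mem_linearExtension_iff hker hJ hy _).mp hu
    obtain ⟨g', h', hg', hd, h0, -⟩ := exists_cofactor hker hJ hJp hy hx (g := g) (h := h) hfe hg
      (by rw [Polynomial.map_add, hug]; simp [mul_comm])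
    set f := u + h * C x
    have hxm : ∀ (I : Ideal A) (a : A), x * a ∈ I ⊔ Ideal.span {x} := fun I a =>
      Ideal.mem_sup_right (Ideal.mul_mem_right _ _ (Ideal.mem_span_singleton_self x))
    have hz : e = 0 → f.coeff e ∈ N ⊔ Ideal.span {x} := by
      rintro rfl
      have hg0 : g' = 0 := by simpa [Nat.WithBot.lt_zero_iff] using hd
      have : f.coeff 0 - x * h'.coeff 0 ∈ N := by
        rw [← hker, RingHom.mem_ker, map_sub, map_mul, sub_eq_zero]
        simpa [hg0] using congrArg (fun u => Polynomial.coeff u 0) h0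
      simpa using add_mem (Ideal.mem_sup_left this) (hxm N (h'.coeff 0))
    refine ⟨hz, ?_⟩
    rcases e with _ | e
    · exact sup_le_sup_right hNJ _ (hz rfl)
    · have hge : g'.coeff (e + 1) = 0 := coeff_eq_zero_of_degree_lt hd
      have : f.coeff (e + 1) - (g'.coeff e + x * h'.coeff (e + 1)) ∈ N := by
        rw [← hker, RingHom.mem_ker, map_sub, map_add, map_mul, sub_eq_zero]
        simpa [mul_sub, hge] using congrArg (fun u => Polynomial.coeff u (e + 1)) h0
      have h3 := add_mem (Ideal.mem_sup_left (hNJ this))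
        (add_mem (Ideal.mem_sup_left (Ideal.mem_map_C_iff.mp hg' e)) (hxm J (h'.coeff (e + 1))))
      simpa using h3
  suffices H : ∀ (e : ℕ) (f : A[X]), f.natDegree < e →
      ∀ k, f ^ k ∈ linearExtension N q r ⊔ Ideal.span {C x} →
        f ∈ linearExtension N q r ⊔ Ideal.span {C x} by
    rintro f ⟨k, hk⟩
    exact H _ f (Nat.lt_succ_self _) k hk
  intro e
  induction e with
  | zero => intro f hf; omega
  | succ e ih =>
    intro f hf k hk
    obtain ⟨h1, h2⟩ := key (f ^ k) (k * e)
      (natDegree_pow_le.trans (Nat.mul_le_mul_left _ (by omega))) hk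
    rw [coeff_pow_of_natDegree_le (by omega)] at h1 h2
    rcases Nat.eq_zero_or_pos e with rfl | he
    · have hmem := hNx ⟨k, h1 (by simp)⟩
      rw [eq_C_of_natDegree_le_zero (p := f) (by omega)]
      have := Ideal.mem_map_of_mem C hmem
      rw [Ideal.map_sup, Ideal.map_span, Set.image_singleton] at this
      exact (sup_le_sup_right le_sup_left _ : N.map C ⊔ _ ≤ _) this
    · obtain ⟨c, hc, v, hv, hcv⟩ := Submodule.mem_sup.mp (hJx ⟨k, h2⟩)
      obtain ⟨a, rfl⟩ := Ideal.mem_span_singleton'.mp hv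
      obtain ⟨e, rfl⟩ : ∃ e', e = e' + 1 := ⟨e - 1, by omega⟩
      obtain ⟨b, hb⟩ := exists_linear_mem_linearExtension (r := r) hJ hc
      set I := linearExtension N q r ⊔ Ideal.span {C x}
      -- An element of the ideal whose top coefficient c + a x is that of f.
      set u : A[X] := X ^ e * (X * C c + C b) + X ^ (e + 1) * (C a * C x) with hu
      have huI : u ∈ I := add_mem (Ideal.mul_mem_left _ _ (Ideal.mem_sup_left hb))
        (Ideal.mul_mem_left _ _ (Ideal.mul_mem_left _ _
          (Ideal.mem_sup_right (Ideal.mem_span_singleton_self _))))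
      have hu' : u = C (c + a * x) * X ^ (e + 1) + C b * X ^ e := by
        simp only [hu, C_add, C_mul]; ring
      have hfu : f - u ∈ I := by
        refine ih (f - u) ?_ k ?_
        · rw [Nat.lt_succ_iff, natDegree_le_iff_coeff_eq_zero]
          intro n hn
          rcases Nat.lt_or_ge (e + 1) n with hn' | hn'
          · simp [hu', -map_add, coeff_X_pow,
            coeff_eq_zero_of_natDegree_lt (show f.natDegree < n by omega),
              show n ≠ e + 1 by omega, show n ≠ e by omega]
          · obtain rfl : n = e + 1 := by omega
            simp [hu', -map_add, coeff_X_pow, ← hcv]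
        · rw [← Ideal.Quotient.eq_zero_iff_mem] at hk huI ⊢
          simpa [huI] using hk
      simpa using add_mem hfu huI

end VertexDecomposition

/-! ### Minors of sums, Schur complements and rank completion. -/

section Minors

open Matrix

variable {A : Type*} [CommRing A] {α β : Type*}

/-- The ideal generated by the `s`-minors of a matrix. -/
def minorsIdeal (M : Matrix α β A) (s : ℕ) : Ideal A :=
  Ideal.span {δ | ∃ (a : Fin s → α) (b : Fin s → β), δ = (M.submatrix a b).det}

theorem det_submatrix_mem_minorsIdeal (M : Matrix α β A) {ι : Type*} [Fintype ι] [DecidableEq ι]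
    {s : ℕ} (hs : Fintype.card ι = s) (a : ι → α) (b : ι → β) :
    (M.submatrix a b).det ∈ minorsIdeal M s := by
  obtain ⟨e⟩ : Nonempty (Fin s ≃ ι) := ⟨(Fintype.equivFinOfCardEq hs).symm⟩
  rw [← det_submatrix_equiv_self e, submatrix_submatrix]
  exact Ideal.subset_span ⟨_, _, rfl⟩

theorem minorsIdeal_le_iff {M : Matrix α β A} {s : ℕ} {I : Ideal A} :
    minorsIdeal M s ≤ I ↔ ∀ (a : Fin s → α) (b : Fin s → β), (M.submatrix a b).det ∈ I := by
  rw [minorsIdeal, Ideal.span_le]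
  constructor
  · exact fun h a b => h ⟨a, b, rfl⟩
  · rintro h _ ⟨a, b, rfl⟩
    exact h a b

theorem map_minorsIdeal {B : Type*} [CommRing B] (f : A →+* B) (M : Matrix α β A) (s : ℕ) :
    (minorsIdeal M s).map f = minorsIdeal (M.map f) s := by
  rw [minorsIdeal, minorsIdeal, Ideal.map_span]
  congr 1
  ext δ
  constructor
  · rintro ⟨_, ⟨a, b, rfl⟩, rfl⟩
    exact ⟨a, b, by rw [RingHom.map_det]; rfl⟩
  · rintro ⟨a, b, rfl⟩
    exact ⟨_, ⟨a, b, rfl⟩, by rw [RingHom.map_det]; rfl⟩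

theorem minorsIdeal_zero (M : Matrix α β A) : minorsIdeal M 0 = ⊤ := by
  rw [Ideal.eq_top_iff_one]
  exact Ideal.subset_span ⟨Fin.elim0, Fin.elim0, by simp⟩

theorem det_mem_of_row_minors_mem {s : ℕ} {M : Matrix (Fin (s + 1)) (Fin (s + 1)) A} {I : Ideal A}
    (i : Fin (s + 1)) (h : ∀ j : Fin (s + 1), (M.submatrix i.succAbove j.succAbove).det ∈ I) :
    M.det ∈ I := by
  rw [det_succ_row M i]
  exact sum_mem fun j _ => Ideal.mul_mem_left _ _ (h j)

theorem det_mem_of_column_minors_mem {s : ℕ} {M : Matrix (Fin (s + 1)) (Fin (s + 1)) A}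
    {I : Ideal A} (j : Fin (s + 1))
    (h : ∀ i : Fin (s + 1), (M.submatrix i.succAbove j.succAbove).det ∈ I) : M.det ∈ I := by
  rw [det_succ_column M j]
  exact sum_mem fun i _ => Ideal.mul_mem_left _ _ (h i)

theorem minorsIdeal_antitone (M : Matrix α β A) : Antitone (minorsIdeal M) := by
  refine antitone_nat_of_succ_le fun s => minorsIdeal_le_iff.mpr fun a b => ?_
  exact det_mem_of_row_minors_mem 0 fun j => Ideal.subset_span ⟨_, _, rfl⟩

/-- The determinant of Y + u vᵀ is that of the bordered matrix with blocks Y, u, -vᵀ, 1. The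
bijection `e` puts the border at index 0; expanding along the border row, and then along the border
column where it remains, leaves minors of Y of size s + 1 and s. -/
theorem minorsIdeal_add_vecMulVec_le (Y : Matrix α β A) (u : α → A) (v : β → A) (s : ℕ) :
    minorsIdeal (Y + vecMulVec u v) (s + 1) ≤ minorsIdeal Y s := by
  refine minorsIdeal_le_iff.mpr fun a b => ?_
  let e : Fin (s + 2) ≃ Fin (s + 1) ⊕ PUnit.{1} :=
    (finSuccEquiv (s + 1)).trans (Equiv.optionEquivSumPUnit _)
  have e0 : e 0 = Sum.inr PUnit.unit := by simp [e]
  have es (i : Fin (s + 1)) : e i.succ = Sum.inl i := by simp [e]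
  let Z : Matrix (Fin (s + 1) ⊕ PUnit.{1}) (Fin (s + 1) ⊕ PUnit.{1}) A :=
    fromBlocks (Y.submatrix a b) (of fun i _ => u (a i)) (of fun _ j => - v (b j)) 1
  have hZ : ((Y + vecMulVec u v).submatrix a b).det = (Z.submatrix e e).det := by
    rw [det_submatrix_equiv_self, det_fromBlocks_one₂₂]
    congr 1
    ext i j
    simp [mul_apply, vecMulVec_apply]
  rw [hZ]
  refine det_mem_of_row_minors_mem 0 fun j => ?_
  cases j using Fin.cases with
  | zero =>
    refine minorsIdeal_antitone Y (Nat.le_succ s) ?_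
    convert det_submatrix_mem_minorsIdeal Y (Fintype.card_fin (s + 1)) a b using 2
    ext i j
    simp [es, Z]
  | succ k =>
    cases s with
    | zero => simp [minorsIdeal_zero]
    | succ s =>
      refine det_mem_of_column_minors_mem 0 fun i => ?_
      convert det_submatrix_mem_minorsIdeal Y (Fintype.card_fin (s + 1))
        (a ∘ i.succAbove) (b ∘ k.succAbove) using 2
      ext i' j'
      simp [es, Z]

theorem minorsIdeal_add_mul_le {r : ℕ} (Y : Matrix α β A) (U : Matrix α (Fin r) A)
    (V : Matrix (Fin r) β A) (s : ℕ) : minorsIdeal (Y + U * V) (s + r) ≤ minorsIdeal Y s := by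
  induction r with
  | zero =>
    have : U * V = 0 := by ext; simp [mul_apply]
    simp [this]
  | succ r ih =>
    have : Y + U * V = (Y + U.submatrix id Fin.succ * V.submatrix Fin.succ id) +
        vecMulVec (fun i => U i 0) (V 0) := by
      ext i j
      simp only [Matrix.add_apply, mul_apply, vecMulVec_apply, Fin.sum_univ_succ,
        submatrix_apply, id]
      ring
    rw [this, ← add_assoc]
    exact (minorsIdeal_add_vecMulVec_le _ _ _ _).trans (ih _ _)

theorem minorsIdeal_le_pow {Y : Matrix α β A} {I : Ideal A} (hY : ∀ i j, Y i j ∈ I) (s : ℕ) :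
    minorsIdeal Y s ≤ I ^ s := by
  refine minorsIdeal_le_iff.mpr fun a b => ?_
  rw [det_apply]
  refine sum_mem fun σ _ => Submodule.smul_of_tower_mem _ _ ?_
  have := Ideal.prod_mem_prod (s := Finset.univ) (I := fun _ : Fin s => I)
    (x := fun i => Y.submatrix a b (σ i) i) (fun i _ => hY _ _)
  simpa using this

theorem det_submatrix_mul_eq_zero {r s : ℕ} (h : r < s) (U : Matrix α (Fin r) A)
    (V : Matrix (Fin r) β A) (a : Fin s → α) (b : Fin s → β) :
    ((U * V).submatrix a b).det = 0 := by
  have h1 := minorsIdeal_add_mul_le (0 : Matrix α β A) U V (s - r)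
  rw [zero_add, Nat.sub_add_cancel h.le] at h1
  have h2 := minorsIdeal_le_pow (Y := (0 : Matrix α β A)) (I := ⊥) (by simp) (s - r)
  rw [Ideal.zero_eq_bot.symm, zero_pow (by omega)] at h2
  simpa using h2 (h1 (Ideal.subset_span ⟨a, b, rfl⟩))

/-- The Schur complement of an invertible square submatrix, as a quotient of minors. -/
theorem det_bordered_submatrix {ι κ : Type*} [Fintype ι] [DecidableEq ι] [Fintype κ]
    [DecidableEq κ] (M : Matrix α β A) (a : ι → α) (b : ι → β) (h : IsUnit (M.submatrix a b).det)
    (c : κ → α) (d : κ → β) :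
    (M.submatrix (Sum.elim a c) (Sum.elim b d)).det = (M.submatrix a b).det *
      ((M - M.submatrix id b * (M.submatrix a b)⁻¹ * M.submatrix a id).submatrix c d).det := by
  have hM : M.submatrix (Sum.elim a c) (Sum.elim b d) = fromBlocks (M.submatrix a b)
      (M.submatrix a d) (M.submatrix c b) (M.submatrix c d) := by
    ext (i | i) (j | j) <;> rfl
  let := (M.submatrix a b).invertibleOfIsUnitDet h
  rw [hM, det_fromBlocks₁₁, invOf_eq_nonsing_inv]
  congr 2

theorem eq_mul_inv_mul_apply_of_det_eq_zero {r : ℕ} (M : Matrix α β A)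
    (a : Fin r → α) (b : Fin r → β) (h : IsUnit (M.submatrix a b).det) (i : α) (j : β)
    (hij : (M.submatrix (Sum.elim a fun _ : Fin 1 => i) (Sum.elim b fun _ : Fin 1 => j)).det = 0) :
    M i j = (M.submatrix id b * (M.submatrix a b)⁻¹ * M.submatrix a id) i j := by
  rw [det_bordered_submatrix M a b h, IsUnit.mul_right_eq_zero h] at hij
  simpa [sub_eq_zero] using hij

theorem det_eq_mul_add_det_of_eq {r : ℕ} {M M' : Matrix (Fin (r + 1)) (Fin (r + 1)) A}
    (h : ∀ i j, (i = Fin.last r → j ≠ Fin.last r) → M i j = M' i j) :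
    M.det = (M (Fin.last r) (Fin.last r) - M' (Fin.last r) (Fin.last r)) *
      (M'.submatrix Fin.castSucc Fin.castSucc).det + M'.det := by
  rw [det_succ_row M (Fin.last r), det_succ_row M' (Fin.last r), Fin.sum_univ_castSucc,
    Fin.sum_univ_castSucc]
  have hs (c : Fin r → Fin (r + 1)) : M.submatrix Fin.castSucc c = M'.submatrix Fin.castSucc c := by
    ext i j
    exact h _ _ fun hi => absurd hi (Fin.castSucc_lt_last i).ne
  have hl (j : Fin r) : M (Fin.last r) j.castSucc = M' (Fin.last r) j.castSucc :=
    h _ _ fun _ => (Fin.castSucc_lt_last j).ne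
  have hsign : (-1 : A) ^ (r + r) = 1 := Even.neg_one_pow ⟨r, rfl⟩
  simp only [Fin.succAbove_last, hs, hl, Fin.val_last, hsign]
  ring

/-- The value at the hole (p, q) is forced. The invertible r-minor determines a matrix M' of rank at
most r, and M' agrees with M at the other positions in rows up to p and columns up to q, as the
bordered minors there vanish. Take y to be the entry of M' at the hole: its (r + 1)-minors vanish,
and they are linear in that entry. -/
theorem exists_rank_completion {F : Type*} [Field F] (M : Matrix ℕ ℕ F) {p q r : ℕ}
    (hpq : M p q = 0) {a₀ b₀ : Fin r → ℕ} (ha₀ : ∀ i, a₀ i < p) (hb₀ : ∀ i, b₀ i < q)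
    (h₀ : (M.submatrix a₀ b₀).det ≠ 0)
    (hM : ∀ a b : Fin (r + 1) → ℕ, (∀ i, a i ≤ p) → (∀ i, b i ≤ q) →
      (∀ i, a i < p) ∨ (∀ i, b i < q) → (M.submatrix a b).det = 0) :
    ∃ y : F, ∀ a b : Fin r → ℕ, (∀ i, a i < p) → (∀ i, b i < q) → y * (M.submatrix a b).det +
      (M.submatrix (Fin.snoc a p : Fin (r + 1) → ℕ) (Fin.snoc b q : Fin (r + 1) → ℕ)).det = 0 := by
  set M' := M.submatrix id b₀ * (M.submatrix a₀ b₀)⁻¹ * M.submatrix a₀ id with hM'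
  have hu : IsUnit (M.submatrix a₀ b₀).det := h₀.isUnit
  have hMM' (i j : ℕ) (hi : i ≤ p) (hj : j ≤ q) (hij : i < p ∨ j < q) : M i j = M' i j := by
    refine eq_mul_inv_mul_apply_of_det_eq_zero M a₀ b₀ hu i j ?_
    rw [← det_submatrix_equiv_self (finSumFinEquiv (m := r) (n := 1)).symm, submatrix_submatrix]
    have ha : ∀ x, Sum.elim a₀ (fun _ : Fin 1 => i) x ≤ p := by
      rintro (l | l)
      exacts [(ha₀ l).le, hi]
    have hb : ∀ x, Sum.elim b₀ (fun _ : Fin 1 => j) x ≤ q := by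
      rintro (l | l)
      exacts [(hb₀ l).le, hj]
    refine hM _ _ (fun _ => ha _) (fun _ => hb _) (hij.imp (fun h k => ?_) fun h k => ?_)
    · have hlt (x) : Sum.elim a₀ (fun _ : Fin 1 => i) x < p := by
        rcases x with l | l
        exacts [ha₀ l, h]
      exact hlt _
    · have hlt (x) : Sum.elim b₀ (fun _ : Fin 1 => j) x < q := by
        rcases x with l | l
        exacts [hb₀ l, h]
      exact hlt _
  refine ⟨M' p q, fun a b ha hb => ?_⟩
  have hdet := det_eq_mul_add_det_of_eq
    (M := M'.submatrix (Fin.snoc a p : Fin (r + 1) → ℕ) (Fin.snoc b q : Fin (r + 1) → ℕ))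
    (M' := M.submatrix (Fin.snoc a p : Fin (r + 1) → ℕ) (Fin.snoc b q : Fin (r + 1) → ℕ)) (by
      intro i j hij
      refine (hMM' _ _ ?_ ?_ ?_).symm
      · cases i using Fin.lastCases <;> simp [(ha _).le]
      · cases j using Fin.lastCases <;> simp [(hb _).le]
      · cases i using Fin.lastCases with
        | cast i => left; simp [ha]
        | last =>
          cases j using Fin.lastCases with
          | cast j => right; simp [hb]
          | last => exact absurd rfl (hij rfl))
  rw [hM', det_submatrix_mul_eq_zero (Nat.lt_succ_self r)] at hdet
  rw [hdet]
  simp [hpq, ← hM', Function.comp_def]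

end Minors

/-! ### Singling out one variable of a polynomial ring. -/

section DeleteVariable

open MvPolynomial

theorem Ideal.comap_map_of_leftInverse {A B : Type*} [CommRing A] [CommRing B] {f : A →+* B}
    {g : B →+* A} (h : Function.LeftInverse g f) (I : Ideal A) : (I.map f).comap f = I := by
  refine le_antisymm (fun x hx => ?_) Ideal.le_comap_map
  have h1 : g (f x) ∈ (I.map f).map g := Ideal.mem_map_of_mem g hx
  have h2 : g.comp f = RingHom.id A := RingHom.ext h
  rwa [Ideal.map_map, h2, Ideal.map_id, h] at h1

theorem Ideal.isPrime_of_map_of_leftInverse {A B : Type*} [CommRing A] [CommRing B] {f : A →+* B}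
    {g : B →+* A} (h : Function.LeftInverse g f) {I : Ideal A} (hI : (I.map f).IsPrime) :
    I.IsPrime := by
  rw [← Ideal.comap_map_of_leftInverse h I]
  infer_instance

theorem Ideal.isRadical_of_map_of_leftInverse {A B : Type*} [CommRing A] [CommRing B]
    {f : A →+* B} {g : B →+* A} (h : Function.LeftInverse g f) {I : Ideal A}
    (hI : (I.map f).IsRadical) : I.IsRadical := by
  rw [← Ideal.comap_map_of_leftInverse h I]
  exact hI.comap f

variable {k : Type*} [CommRing k] {σ : Type*}

/-- A polynomial ring as a univariate polynomial ring in the variable `y`. -/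
noncomputable def splitVariable (k : Type*) [CommRing k] [DecidableEq σ] (y : σ) :
    MvPolynomial σ k ≃ₐ[k] Polynomial (MvPolynomial {i // i ≠ y} k) :=
  (renameEquiv k (Equiv.optionSubtypeNe y).symm).trans (optionEquivLeft k _)

/-- The inclusion of the polynomials that do not involve the variable `y`. -/
noncomputable def includeNe (k : Type*) [CommRing k] (y : σ) :
    MvPolynomial {i // i ≠ y} k →ₐ[k] MvPolynomial σ k :=
  rename Subtype.val

/-- The substitution `y = 0`. -/
noncomputable def killVariable (k : Type*) [CommRing k] [DecidableEq σ] (y : σ) :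
    MvPolynomial σ k →ₐ[k] MvPolynomial {i // i ≠ y} k :=
  aeval fun i => if h : i ≠ y then X ⟨i, h⟩ else 0

theorem includeNe_X (y : σ) (i : {i // i ≠ y}) : includeNe k y (X i) = X i.1 := rename_X _ _

variable [DecidableEq σ]

theorem killVariable_includeNe (y : σ) (f : MvPolynomial {i // i ≠ y} k) :
    killVariable k y (includeNe k y f) = f := by
  have : (killVariable k y).comp (includeNe k y) = AlgHom.id k _ := by
    ext i
    simp [killVariable, includeNe, i.2]
  exact DFunLike.congr_fun this f

theorem leftInverse_killVariable (y : σ) :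
    Function.LeftInverse (killVariable k y).toRingHom (includeNe k y).toRingHom :=
  killVariable_includeNe y

theorem splitVariable_X (y : σ) : splitVariable k y (X y) = Polynomial.X := by
  simp [splitVariable]

theorem splitVariable_includeNe (y : σ) (f : MvPolynomial {i // i ≠ y} k) :
    splitVariable k y (includeNe k y f) = Polynomial.C f := by
  have : (splitVariable k y).toAlgHom.comp (includeNe k y) = Polynomial.CAlgHom := by
    ext i
    simp [splitVariable, includeNe, i.2]
  exact DFunLike.congr_fun this f

theorem sub_includeNe_killVariable_mem (y : σ) (f : MvPolynomial σ k) :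
    f - includeNe k y (killVariable k y f) ∈ Ideal.span {X y} := by
  rw [← Ideal.Quotient.eq_zero_iff_mem, map_sub, sub_eq_zero]
  let φ := Ideal.Quotient.mkₐ k (Ideal.span {(X y : MvPolynomial σ k)})
  have : φ = φ.comp ((includeNe k y).comp (killVariable k y)) := by
    ext i
    by_cases h : i = y
    · subst h
      simp [φ, killVariable, includeNe]
    · simp [φ, killVariable, includeNe, h]
  exact DFunLike.congr_fun this f

/-- As a preimage under y = 0, the ideal inherits primality and radicality from N; this settles the
case in which the new variable itself joins the ideal. -/
theorem map_includeNe_sup_span_X (y : σ) (N : Ideal (MvPolynomial {i // i ≠ y} k)) :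
    N.map (includeNe k y).toRingHom ⊔ Ideal.span {X y} = N.comap (killVariable k y).toRingHom := by
  apply le_antisymm
  · rw [sup_le_iff, Ideal.map_le_iff_le_comap, Ideal.span_le, Set.singleton_subset_iff]
    refine ⟨fun f hf => ?_, ?_⟩
    · rw [Ideal.mem_comap, Ideal.mem_comap, leftInverse_killVariable y f]
      exact hf
    · simp [killVariable]
  · intro f hf
    have h1 := Ideal.mem_map_of_mem (includeNe k y).toRingHom (Ideal.mem_comap.mp hf)
    have h2 := sub_includeNe_killVariable_mem y f
    exact (add_sub_cancel _ f) ▸ add_mem (Ideal.mem_sup_left h1) (Ideal.mem_sup_right h2)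

/-- The ideal generated by `N` and the polynomials `q i * y + r i`. -/
noncomputable def linearExtensionAt (y : σ) {κ : Type*} (N : Ideal (MvPolynomial {i // i ≠ y} k))
    (q r : κ → MvPolynomial {i // i ≠ y} k) : Ideal (MvPolynomial σ k) :=
  N.map (includeNe k y).toRingHom ⊔
    Ideal.span (Set.range fun i => X y * includeNe k y (q i) + includeNe k y (r i))

theorem leftInverse_splitVariable_symm (y : σ) :
    Function.LeftInverse (splitVariable k y).symm.toAlgHom.toRingHom
      (splitVariable k y).toAlgHom.toRingHom :=
  (splitVariable k y).symm_apply_apply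

theorem map_splitVariable_map_includeNe (y : σ) (N : Ideal (MvPolynomial {i // i ≠ y} k)) :
    (N.map (includeNe k y).toRingHom).map (splitVariable k y).toAlgHom.toRingHom =
      N.map Polynomial.C := by
  rw [Ideal.map_map]
  congr 1
  exact RingHom.ext fun f => splitVariable_includeNe y f

theorem map_splitVariable_linearExtensionAt (y : σ) {κ : Type*}
    (N : Ideal (MvPolynomial {i // i ≠ y} k)) (q r : κ → MvPolynomial {i // i ≠ y} k) :
    (linearExtensionAt y N q r).map (splitVariable k y).toAlgHom.toRingHom =
      linearExtension N q r := by
  rw [linearExtensionAt, linearExtension, Ideal.map_sup, map_splitVariable_map_includeNe]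
  congr 1
  rw [Ideal.map_span, ← Set.range_comp]
  congr 2
  ext1 i
  simp [splitVariable_includeNe, splitVariable_X]

variable {y : σ} {κ : Type*} {N J : Ideal (MvPolynomial {i // i ≠ y} k)}
    {q r : κ → MvPolynomial {i // i ≠ y} k} {F : Type*} [Field F]
    {π : MvPolynomial {i // i ≠ y} k →+* F} {z : F}

theorem isPrime_linearExtensionAt (hker : RingHom.ker π = N)
    (hJ : J = N ⊔ Ideal.span (Set.range q)) (hJp : J.IsPrime)
    (hz : ∀ i, z * π (q i) + π (r i) = 0) {i : κ} (hi : r i ∉ J) :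
    (linearExtensionAt y N q r).IsPrime := by
  have := isPrime_linearExtension hker hJ hJp hz hi
  rw [← map_splitVariable_linearExtensionAt] at this
  exact Ideal.isPrime_of_map_of_leftInverse (leftInverse_splitVariable_symm y) this

theorem isRadical_linearExtensionAt_sup (hker : RingHom.ker π = N)
    (hJ : J = N ⊔ Ideal.span (Set.range q)) (hJp : J.IsPrime)
    (hz : ∀ i, z * π (q i) + π (r i) = 0) {x : MvPolynomial {i // i ≠ y} k} (hx : x ∉ J)
    (hNx : (N ⊔ Ideal.span {x}).IsRadical) (hJx : (J ⊔ Ideal.span {x}).IsRadical) :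
    (linearExtensionAt y N q r ⊔ Ideal.span {includeNe k y x}).IsRadical := by
  have := isRadical_linearExtension_sup hker hJ hJp hz hx hNx hJx
  have hs : linearExtension N q r ⊔ Ideal.span {Polynomial.C x} = (linearExtensionAt y N q r ⊔
      Ideal.span {includeNe k y x}).map (splitVariable k y).toAlgHom.toRingHom := by
    rw [Ideal.map_sup, map_splitVariable_linearExtensionAt, Ideal.map_span, Set.image_singleton]
    congr 3
    exact (splitVariable_includeNe y x).symm
  rw [hs] at this
  exact Ideal.isRadical_of_map_of_leftInverse (leftInverse_splitVariable_symm y) this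

end DeleteVariable

/-! ### Ladder ideals and the effect of one new entry. -/

section Ladder

open Matrix

variable {A : Type*} [CommRing A]

/-- The ideal expressing, for `l ≤ n`, that the first `l` columns and the first `p` rows of a matrix
have rank at most `ρ l`, and that the same holds for the first `p + 1` rows when `l ≤ q`. -/
def ladderIdeal (M : Matrix ℕ ℕ A) (n p q : ℕ) (ρ : ℕ → ℕ) : Ideal A :=
  Ideal.span {δ | ∃ l ≤ n, ∃ a b : Fin (ρ l + 1) → ℕ, (∀ i, b i < l) ∧
    (∀ i, a i < p ∨ (a i = p ∧ l ≤ q)) ∧ δ = (M.submatrix a b).det}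

/-- Functions that bound the rank of the first columns of a matrix. -/
structure IsRankFunction (ρ : ℕ → ℕ) : Prop where
  zero : ρ 0 = 0
  le_succ : ∀ j, ρ j ≤ ρ (j + 1)
  succ_le : ∀ j, ρ (j + 1) ≤ ρ j + 1

variable {M M' : Matrix ℕ ℕ A} {n p q : ℕ} {ρ : ℕ → ℕ}

theorem IsRankFunction.mono (h : IsRankFunction ρ) : Monotone ρ := monotone_nat_of_le_succ h.le_succ

theorem IsRankFunction.card_filter_range (h : IsRankFunction ρ) (l : ℕ) :
    ((Finset.range l).filter fun j => ρ (j + 1) = ρ j + 1).card = ρ l := by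
  induction l with
  | zero => simp [h.zero]
  | succ l ih =>
    rw [Finset.range_add_one, Finset.filter_insert]
    have h1 := h.le_succ l
    have h2 := h.succ_le l
    split_ifs with hl
    · rw [Finset.card_insert_of_notMem (by simp), ih, hl]
    · omega

theorem IsRankFunction.exists_jump (h : IsRankFunction ρ) {m l : ℕ} (hm : m < ρ l) :
    ∃ j < l, ρ j = m ∧ ρ (j + 1) = m + 1 := by
  induction l with
  | zero => simp [h.zero] at hm
  | succ l ih =>
    by_cases hl : m < ρ l
    · obtain ⟨j, hj, hj'⟩ := ih hl
      exact ⟨j, by omega, hj'⟩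
    · have h2 := h.succ_le l
      exact ⟨l, by omega, by omega, by omega⟩

theorem ladderIdeal_le_iff {I : Ideal A} : ladderIdeal M n p q ρ ≤ I ↔
    ∀ (l s : ℕ), l ≤ n → s = ρ l + 1 → ∀ a b : Fin s → ℕ, (∀ i, b i < l) →
      (∀ i, a i < p ∨ (a i = p ∧ l ≤ q)) → (M.submatrix a b).det ∈ I := by
  rw [ladderIdeal, Ideal.span_le]
  constructor
  · rintro h l s hl rfl a b hb ha
    exact h ⟨l, hl, a, b, hb, ha, rfl⟩
  · rintro h _ ⟨l, hl, a, b, hb, ha, rfl⟩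
    exact h l _ hl rfl a b hb ha

theorem det_mem_ladderIdeal {l s : ℕ} (hl : l ≤ n) (hs : s = ρ l + 1) {a b : Fin s → ℕ}
    (hb : ∀ i, b i < l) (ha : ∀ i, a i < p ∨ (a i = p ∧ l ≤ q)) :
    (M.submatrix a b).det ∈ ladderIdeal M n p q ρ :=
  ladderIdeal_le_iff.mp le_rfl l s hl hs a b hb ha

theorem map_ladderIdeal {B : Type*} [CommRing B] (f : A →+* B) :
    (ladderIdeal M n p q ρ).map f = ladderIdeal (M.map f) n p q ρ := by
  rw [ladderIdeal, ladderIdeal, Ideal.map_span]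
  congr 1
  ext δ
  constructor
  · rintro ⟨_, ⟨l, hl, a, b, hb, ha, rfl⟩, rfl⟩
    exact ⟨l, hl, a, b, hb, ha, by rw [RingHom.map_det]; rfl⟩
  · rintro ⟨l, hl, a, b, hb, ha, rfl⟩
    exact ⟨_, ⟨l, hl, a, b, hb, ha, rfl⟩, by rw [RingHom.map_det]; rfl⟩

theorem ladderIdeal_congr {c : ℕ} (hc : c ≤ q)
    (h : ∀ i j, (i, j) ≠ (p, q) → M i j = M' i j) :
    ladderIdeal M n p c ρ = ladderIdeal M' n p c ρ := by
  have key {l s : ℕ} {a b : Fin s → ℕ} (hb : ∀ i, b i < l)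
      (ha : ∀ i, a i < p ∨ (a i = p ∧ l ≤ c)) : M.submatrix a b = M'.submatrix a b := by
    ext i j
    refine h _ _ fun hij => ?_
    simp only [Prod.mk.injEq] at hij
    have h1 := hb j
    rcases ha i with h2 | h2 <;> omega
  refine le_antisymm (ladderIdeal_le_iff.mpr fun l s hl hs a b hb ha => ?_)
    (ladderIdeal_le_iff.mpr fun l s hl hs a b hb ha => ?_)
  · rw [key hb ha]
    exact det_mem_ladderIdeal hl hs hb ha
  · rw [← key hb ha]
    exact det_mem_ladderIdeal hl hs hb ha

theorem ladderIdeal_zero_zero : ladderIdeal M n 0 0 ρ = ⊥ := by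
  rw [eq_bot_iff, ladderIdeal_le_iff]
  rintro l s hl rfl a b hb ha
  have h1 := hb 0
  rcases ha 0 with h | h <;> omega

theorem ladderIdeal_succ_zero : ladderIdeal M n (p + 1) 0 ρ = ladderIdeal M n p n ρ := by
  apply le_antisymm
  · refine ladderIdeal_le_iff.mpr ?_
    rintro l s hl rfl a b hb ha
    refine det_mem_ladderIdeal hl rfl hb fun i => ?_
    have h1 := hb i
    rcases ha i with h | h <;> omega
  · refine ladderIdeal_le_iff.mpr ?_
    rintro l s hl rfl a b hb ha
    refine det_mem_ladderIdeal hl rfl hb fun i => ?_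
    rcases ha i with h | h <;> omega

theorem ladderIdeal_le_succ : ladderIdeal M n p q ρ ≤ ladderIdeal M n p (q + 1) ρ :=
  ladderIdeal_le_iff.mpr fun _ _ hl hs _ _ hb ha => det_mem_ladderIdeal hl hs hb fun i =>
    (ha i).imp id fun h => ⟨h.1, h.2.trans (Nat.le_succ q)⟩

theorem ladderIdeal_succ_le_iff (hq : q < n) {I : Ideal A} (hI : ladderIdeal M n p q ρ ≤ I) :
    ladderIdeal M n p (q + 1) ρ ≤ I ↔ ∀ (s : ℕ), s = ρ (q + 1) + 1 → ∀ a b : Fin s → ℕ,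
      (∀ i, b i ≤ q) → (∀ i, a i ≤ p) → (M.submatrix a b).det ∈ I := by
  constructor
  · intro h s hs a b hb ha
    refine h (det_mem_ladderIdeal (l := q + 1) hq hs (fun i => Nat.lt_succ_of_le (hb i))
      fun i => ?_)
    have := ha i
    omega
  · intro h
    rw [ladderIdeal_le_iff]
    intro l s hl hs a b hb ha
    by_cases hlq : l = q + 1
    · subst hlq
      exact h s hs a b (fun i => Nat.le_of_lt_succ (hb i)) fun i => by have := ha i; omega
    · refine hI (det_mem_ladderIdeal hl hs hb fun i => ?_)
      have := ha i
      omega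

/-- The new minors are one larger than those for the first q columns. Unless column q is repeated,
expansion along it, or along any column if it does not occur, leads back to the old ones. -/
theorem ladderIdeal_succ_of_jump (hq : q < n) (hρ : ρ (q + 1) = ρ q + 1) :
    ladderIdeal M n p (q + 1) ρ = ladderIdeal M n p q ρ := by
  refine le_antisymm ?_ ladderIdeal_le_succ
  rw [ladderIdeal_succ_le_iff hq le_rfl, hρ]
  rintro s rfl a b hb ha
  by_cases hex : ∃ c, b c = q
  · obtain ⟨c, hc⟩ := hex
    by_cases hex' : ∃ c' ≠ c, b c' = q
    · obtain ⟨c', hcc', hc'⟩ := hex'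
      rw [det_zero_of_column_eq hcc' (fun i => by simp [hc, hc'])]
      exact zero_mem _
    · push Not at hex'
      refine det_mem_of_column_minors_mem c fun i => ?_
      refine det_mem_ladderIdeal (l := q) hq.le rfl (fun j => ?_) fun j => ?_
      · exact lt_of_le_of_ne (hb _) (hex' _ (Fin.succAbove_ne _ _))
      · have := ha (i.succAbove j)
        omega
  · push Not at hex
    refine det_mem_of_column_minors_mem 0 fun i => ?_
    refine det_mem_ladderIdeal (l := q) hq.le rfl (fun j => ?_) fun j => ?_
    · exact lt_of_le_of_ne (hb _) (hex _)
    · have := ha (i.succAbove j)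
      omega

theorem det_submatrix_eq_zero_of_card_lt {s m : ℕ} (hm : m < s) (a b : Fin s → ℕ)
    (ha : ∀ i, a i < m) : (M.submatrix a b).det = 0 := by
  obtain ⟨i, j, hij, h⟩ := Fintype.exists_ne_map_eq_of_card_lt
    (fun i => (⟨a i, ha i⟩ : Fin m)) (by simpa)
  have : a i = a j := by simpa using h
  exact det_zero_of_row_eq hij (by ext k; simp [this])

theorem det_submatrix_eq_zero_of_card_columns_lt {s : ℕ} (T : Finset ℕ) (hT : T.card < s)
    (a b : Fin s → ℕ) (h : ∀ i j, b j ∉ T → M (a i) (b j) = 0) : (M.submatrix a b).det = 0 := by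
  by_cases hb : ∀ j, b j ∈ T
  · obtain ⟨i, j, hij, h⟩ := Fintype.exists_ne_map_eq_of_card_lt
      (fun i => (⟨b i, hb i⟩ : T)) (by simpa)
    have : b i = b j := by simpa using h
    exact det_zero_of_column_eq hij (by simp [this])
  · push Not at hb
    obtain ⟨j, hj⟩ := hb
    exact det_eq_zero_of_column_eq_zero j fun i => h i j hj

theorem ladderIdeal_succ_of_lt (hq : q < n) (hρ : p < ρ (q + 1)) :
    ladderIdeal M n p (q + 1) ρ = ladderIdeal M n p q ρ := by
  refine le_antisymm ?_ ladderIdeal_le_succ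
  rw [ladderIdeal_succ_le_iff hq le_rfl]
  rintro s rfl a b hb ha
  rw [det_submatrix_eq_zero_of_card_lt (m := p + 1) (by omega) a b fun i =>
    Nat.lt_succ_of_le (ha i)]
  exact zero_mem _

theorem ladderIdeal_succ_of_eq_zero (hq : q < n) (h0 : ρ q = 0) (h1 : ρ (q + 1) = 0) :
    ladderIdeal M n p (q + 1) ρ = ladderIdeal M n p q ρ ⊔ Ideal.span {M p q} := by
  apply le_antisymm
  · rw [ladderIdeal_succ_le_iff hq le_sup_left, h1]
    rintro s rfl a b hb ha
    by_cases hpq : a 0 = p ∧ b 0 = q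
    · refine Ideal.mem_sup_right ?_
      rw [det_fin_one, submatrix_apply, hpq.1, hpq.2]
      exact Ideal.mem_span_singleton_self _
    · refine Ideal.mem_sup_left ?_
      have ha0 := ha 0
      have hb0 := hb 0
      by_cases hbq : b 0 < q
      · refine det_mem_ladderIdeal (l := q) hq.le (by omega) (fun i => ?_) (fun i => ?_) <;>
        obtain rfl := Fin.fin_one_eq_zero i <;> omega
      · refine det_mem_ladderIdeal (l := q + 1) hq (by omega) (fun i => ?_) (fun i => ?_) <;>
        obtain rfl := Fin.fin_one_eq_zero i <;> omega
  · rw [sup_le_iff, Ideal.span_le, Set.singleton_subset_iff]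
    refine ⟨ladderIdeal_le_succ, ?_⟩
    have := det_mem_ladderIdeal (M := M) (n := n) (p := p) (q := q + 1) (ρ := ρ) (l := q + 1)
      (s := 1) hq (by omega) (a := fun _ => p) (b := fun _ => q) (by simp) (by simp)
    simpa using this

theorem det_mem_of_det_submatrix_perm_mem {s : ℕ} {N : Matrix (Fin s) (Fin s) A} {I : Ideal A}
    (σ τ : Equiv.Perm (Fin s)) (h : (N.submatrix σ τ).det ∈ I) : N.det ∈ I := by
  have : (N.submatrix σ τ).det = (Equiv.Perm.sign τ : A) * ((Equiv.Perm.sign σ : A) * N.det) := by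
    rw [← det_permute, ← det_permute', submatrix_submatrix]
    rfl
  rw [this] at h
  have hu (σ : Equiv.Perm (Fin s)) : IsUnit (Equiv.Perm.sign σ : A) := by
    rcases Int.units_eq_one_or (Equiv.Perm.sign σ) with h | h <;> simp [h]
  exact (Ideal.unit_mul_mem_iff_mem _ (hu σ)).mp ((Ideal.unit_mul_mem_iff_mem _ (hu τ)).mp h)

/-- A minor that avoids column q or row p is already present, with l = q or l = q + 1. One that
repeats either vanishes, and a permutation moves the remaining ones into bordered form. -/
theorem ladderIdeal_succ_eq_sup (hq : q < n) {r : ℕ} (h0 : ρ q = r) (h1 : ρ (q + 1) = r) :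
    ladderIdeal M n p (q + 1) ρ = ladderIdeal M n p q ρ ⊔ Ideal.span (Set.range
      fun ab : {ab : (Fin r → ℕ) × (Fin r → ℕ) // (∀ i, ab.1 i < p) ∧ ∀ i, ab.2 i < q} =>
        (M.submatrix (Fin.snoc ab.1.1 p : Fin (r + 1) → ℕ)
          (Fin.snoc ab.1.2 q : Fin (r + 1) → ℕ)).det) := by
  apply le_antisymm
  · rw [ladderIdeal_succ_le_iff hq le_sup_left, h1]
    rintro s rfl a b hb ha
    by_cases hbq : ∀ i, b i < q
    · refine Ideal.mem_sup_left (det_mem_ladderIdeal (l := q) hq.le (by omega) hbq fun i => ?_)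
      have := ha i
      omega
    by_cases hap : ∀ i, a i < p
    · refine Ideal.mem_sup_left (det_mem_ladderIdeal (l := q + 1) hq (by omega)
        (fun i => Nat.lt_succ_of_le (hb i)) fun i => Or.inl (hap i))
    push Not at hbq hap
    obtain ⟨i₀, hi₀⟩ := hap
    obtain ⟨j₀, hj₀⟩ := hbq
    replace hi₀ := le_antisymm (ha i₀) hi₀
    replace hj₀ := le_antisymm (hb j₀) hj₀
    by_cases hi : ∃ i ≠ i₀, a i = p
    · obtain ⟨i, hne, hi⟩ := hi
      rw [det_zero_of_row_eq hne (by ext; simp [hi, hi₀])]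
      exact zero_mem _
    by_cases hj : ∃ j ≠ j₀, b j = q
    · obtain ⟨j, hne, hj⟩ := hj
      rw [det_zero_of_column_eq hne (by simp [hj, hj₀])]
      exact zero_mem _
    push Not at hi hj
    refine Ideal.mem_sup_right (det_mem_of_det_submatrix_perm_mem
      (Equiv.swap i₀ (Fin.last r)) (Equiv.swap j₀ (Fin.last r)) ?_)
    rw [submatrix_submatrix]
    refine Ideal.subset_span ⟨⟨⟨fun i => a (Equiv.swap i₀ (Fin.last r) i.castSucc),
      fun j => b (Equiv.swap j₀ (Fin.last r) j.castSucc)⟩, fun i => ?_, fun j => ?_⟩, ?_⟩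
    · refine lt_of_le_of_ne (ha _) (hi _ fun h => ?_)
      rw [Equiv.swap_apply_eq_iff, Equiv.swap_apply_left] at h
      exact (Fin.castSucc_lt_last i).ne h
    · refine lt_of_le_of_ne (hb _) (hj _ fun h => ?_)
      rw [Equiv.swap_apply_eq_iff, Equiv.swap_apply_left] at h
      exact (Fin.castSucc_lt_last j).ne h
    · have e1 : (Fin.snoc (fun i => a (Equiv.swap i₀ (Fin.last r) i.castSucc)) p :
          Fin (r + 1) → ℕ) = a ∘ Equiv.swap i₀ (Fin.last r) := by
        ext i
        cases i using Fin.lastCases <;> simp [hi₀]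
      have e2 : (Fin.snoc (fun i => b (Equiv.swap j₀ (Fin.last r) i.castSucc)) q :
          Fin (r + 1) → ℕ) = b ∘ Equiv.swap j₀ (Fin.last r) := by
        ext i
        cases i using Fin.lastCases <;> simp [hj₀]
      simp only [e1, e2]
  · rw [sup_le_iff, Ideal.span_le]
    refine ⟨ladderIdeal_le_succ, ?_⟩
    rintro _ ⟨⟨⟨a, b⟩, ha, hb⟩, rfl⟩
    refine det_mem_ladderIdeal (l := q + 1) hq (by omega) (fun i => ?_) (fun i => ?_)
    · cases i using Fin.lastCases with
      | last => simp
      | cast i => simpa using (hb i).trans (Nat.lt_succ_self q)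
    · cases i using Fin.lastCases with
      | last => simp
      | cast i => simpa using Or.inl (ha i)

/-- The rank function obtained from `ρ` by bounding the rank of the first `q` columns by `m`. -/
def truncateRank (ρ : ℕ → ℕ) (q m j : ℕ) : ℕ := if j ≤ q then min (ρ j) m else ρ j

theorem IsRankFunction.truncateRank (h : IsRankFunction ρ) {m : ℕ} (hm : ρ (q + 1) = m + 1) :
    IsRankFunction (truncateRank ρ q m) where
  zero := by simp [_root_.truncateRank, h.zero]
  le_succ j := by
    have h1 := h.le_succ j
    simp only [_root_.truncateRank]
    split_ifs <;> omega
  succ_le j := by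
    have h1 := h.le_succ j
    have h2 := h.succ_le j
    simp only [_root_.truncateRank]
    split_ifs with h3 h4 h4
    · omega
    · omega
    · obtain rfl : j = q := by omega
      omega
    · omega

/-- Here c is the last jump before q, so ρ equals m + 1 for c < l ≤ q. In this range the (m +
2)-minors that use row p expand along that row into (m + 1)-minors of the first p rows. Hence row p
matters only up to column c, and the ideal is a ladder ideal with a shorter last row. -/
theorem ladderIdeal_truncateRank (hq : q < n) (hρ : IsRankFunction ρ) {m c : ℕ}
    (h0 : ρ q = m + 1) (hc : ρ c = m) (hc' : ρ (c + 1) = m + 1) :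
    ladderIdeal M n p c (truncateRank ρ q m) = ladderIdeal M n p q ρ ⊔ Ideal.span (Set.range
      fun ab : {ab : (Fin (m + 1) → ℕ) × (Fin (m + 1) → ℕ) //
        (∀ i, ab.1 i < p) ∧ ∀ i, ab.2 i < q} => (M.submatrix ab.1.1 ab.1.2).det) := by
  have hcq : c < q := by
    by_contra! h
    have := hρ.mono h
    omega
  have hlc (l : ℕ) (hl : ρ l ≤ m) : l ≤ c := by
    by_contra! h
    have := hρ.mono (Nat.succ_le_of_lt h)
    rw [Nat.succ_eq_add_one, hc'] at this
    omega
  have htq : truncateRank ρ q m q = m := by simp [truncateRank, h0]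
  apply le_antisymm
  · rw [ladderIdeal_le_iff]
    intro l s hl hs a b hb ha
    by_cases hlq : l ≤ q
    · simp only [truncateRank, hlq, if_true] at hs
      rcases Nat.lt_or_ge m (ρ l) with h | h
      · obtain rfl : s = m + 1 := by omega
        have hcl : c < l := by
          by_contra! h'
          have := hρ.mono h'
          omega
        refine Ideal.mem_sup_right (Ideal.subset_span ⟨⟨⟨a, b⟩, fun i => ?_, fun i => ?_⟩, rfl⟩)
        · have := ha i
          change a i < p
          omega
        · exact (hb i).trans_le hlq
      · refine Ideal.mem_sup_left (det_mem_ladderIdeal hl (by omega) hb fun i => ?_)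
        have := ha i
        omega
    · simp only [truncateRank, hlq, if_false] at hs
      refine Ideal.mem_sup_left (det_mem_ladderIdeal hl hs hb fun i => ?_)
      have := ha i
      omega
  · rw [sup_le_iff, Ideal.span_le]
    constructor
    · rw [ladderIdeal_le_iff]
      intro l s hl hs a b hb ha
      by_cases hlq : l ≤ q
      · rcases Nat.lt_or_ge m (ρ l) with h | h
        · have hlm : ρ l = m + 1 := by
            have := hρ.mono hlq
            omega
          subst hs
          -- The row to expand along is the one equal to p, or any row if p does not occur; a second
          -- occurrence of p makes the minor zero.
          have hex : ∃ i, ∀ i' ≠ i, a i' < p ∨ ∃ i'' ≠ i', a i'' = a i' := by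
            by_cases h : ∃ i, a i = p
            · obtain ⟨i, hi⟩ := h
              refine ⟨i, fun i' hi' => ?_⟩
              rcases ha i' with h | h
              · exact Or.inl h
              · exact Or.inr ⟨i, hi'.symm, hi.trans h.1.symm⟩
            · push Not at h
              refine ⟨0, fun i' _ => Or.inl ?_⟩
              have h1 := ha i'
              have h2 := h i'
              omega
          obtain ⟨i, hi⟩ := hex
          by_cases hdup : ∃ i' i'', i'' ≠ i' ∧ a i'' = a i'
          · obtain ⟨i', i'', hne, h⟩ := hdup
            rw [det_zero_of_row_eq hne (by ext; simp [h])]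
            exact zero_mem _
          · push Not at hdup
            refine det_mem_of_row_minors_mem i fun j => ?_
            refine det_mem_ladderIdeal (l := q) hq.le (by omega) (fun j' => ?_) (fun i' => ?_)
            · exact (hb _).trans_le hlq
            · rcases hi (i.succAbove i') (Fin.succAbove_ne _ _) with h | ⟨i'', h, h'⟩
              · exact Or.inl h
              · exact absurd h' (hdup _ _ h)
        · refine det_mem_ladderIdeal hl ?_ hb fun i => ?_
          · simp only [truncateRank, hlq, if_true]
            omega
          · have h1 := ha i
            have h2 := hlc l h
            omega
      · refine det_mem_ladderIdeal hl ?_ hb fun i => ?_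
        · simp [truncateRank, hlq, hs]
        · have h1 := ha i
          omega
    · rintro _ ⟨⟨⟨a, b⟩, ha, hb⟩, rfl⟩
      exact det_mem_ladderIdeal hq.le (by omega) hb fun i => Or.inl (ha i)

end Ladder

/-! ### Primality of ladder ideals of a generic matrix. -/

section LadderPrime

open Matrix MvPolynomial

variable {k : Type*} [CommRing k]

/-- The generic `ℕ × ℕ` matrix with the entry at `y` replaced by zero. -/
noncomputable def puncturedMatrix (k : Type*) [CommRing k] (y : ℕ × ℕ) :
    Matrix ℕ ℕ (MvPolynomial {i : ℕ × ℕ // i ≠ y} k) :=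
  (mvPolynomialX ℕ ℕ k).map (killVariable k y).toRingHom

theorem puncturedMatrix_self (p q : ℕ) : puncturedMatrix k (p, q) p q = 0 := by
  simp [puncturedMatrix, killVariable]

theorem puncturedMatrix_of_ne {y : ℕ × ℕ} {i j : ℕ} (h : (i, j) ≠ y) :
    puncturedMatrix k y i j = X ⟨(i, j), h⟩ := by
  simp [puncturedMatrix, killVariable, h]

theorem map_includeNe_puncturedMatrix {y : ℕ × ℕ} (i j : ℕ) (h : (i, j) ≠ y) :
    (puncturedMatrix k y).map (includeNe k y).toRingHom i j = mvPolynomialX ℕ ℕ k i j := by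
  simp [puncturedMatrix_of_ne h, includeNe]

theorem map_eval_puncturedMatrix {y : ℕ × ℕ} (E : Matrix ℕ ℕ k) (hE : E y.1 y.2 = 0) :
    (puncturedMatrix k y).map (eval fun i => E i.1.1 i.1.2) = E := by
  ext i j
  by_cases h : (i, j) = y
  · subst h
    simp [puncturedMatrix_self, hE]
  · simp [puncturedMatrix_of_ne h]

theorem map_includeNe_ladderIdeal {n p q c : ℕ} (hc : c ≤ q) (ρ : ℕ → ℕ) :
    (ladderIdeal (puncturedMatrix k (p, q)) n p c ρ).map (includeNe k (p, q)).toRingHom =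
      ladderIdeal (mvPolynomialX ℕ ℕ k) n p c ρ := by
  rw [map_ladderIdeal]
  exact ladderIdeal_congr hc map_includeNe_puncturedMatrix

theorem notMem_ladderIdeal_of_eval {y : ℕ × ℕ} {n p c : ℕ} {ρ : ℕ → ℕ} (E : Matrix ℕ ℕ k)
    (hy : E y.1 y.2 = 0) (hE : ladderIdeal E n p c ρ = ⊥)
    {f : MvPolynomial {i : ℕ × ℕ // i ≠ y} k} (hf : eval (fun i => E i.1.1 i.1.2) f ≠ 0) :
    f ∉ ladderIdeal (puncturedMatrix k y) n p c ρ := by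
  intro h
  have := Ideal.mem_map_of_mem (eval fun i : {i : ℕ × ℕ // i ≠ y} => E i.1.1 i.1.2) h
  rw [map_ladderIdeal, map_eval_puncturedMatrix E hy, hE] at this
  exact hf this

theorem eval_det_puncturedMatrix {y : ℕ × ℕ} (E : Matrix ℕ ℕ k) (hy : E y.1 y.2 = 0) {s : ℕ}
    (a b : Fin s → ℕ) : eval (fun i => E i.1.1 i.1.2) ((puncturedMatrix k y).submatrix a b).det =
      (E.submatrix a b).det := by
  rw [RingHom.map_det, RingHom.mapMatrix_apply, ← submatrix_map, map_eval_puncturedMatrix E hy]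

theorem ladderIdeal_eq_bot {n p c : ℕ} {ρ : ℕ → ℕ} {E : Matrix ℕ ℕ k}
    (h : ∀ l ≤ n, ∃ T : Finset ℕ, T.card ≤ ρ l ∧ ∀ i j, j < l → (i < p ∨ i = p ∧ l ≤ c) →
      j ∉ T → E i j = 0) : ladderIdeal E n p c ρ = ⊥ := by
  rw [eq_bot_iff, ladderIdeal_le_iff]
  intro l s hl hs a b hb ha
  obtain ⟨T, hT, hE⟩ := h l hl
  exact det_submatrix_eq_zero_of_card_columns_lt T (by omega) a b fun i j hj =>
    hE _ _ (hb j) (ha i) hj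

variable {n p q : ℕ} {ρ : ℕ → ℕ}

/-- Specialize to the matrix with ones at (ρ j, j) for the jumps j. Its first l columns contain only
ρ l nonzero ones, so the ladder ideal vanishes, but the minor on the first r rows and jump columns
is 1. -/
theorem exists_minor_notMem_ladderIdeal [Nontrivial k] (hρ : IsRankFunction ρ) {r : ℕ}
    (h0 : ρ q = r) (h1 : ρ (q + 1) = r) (hr : r ≤ p) :
    ∃ a b : Fin r → ℕ, (∀ i, a i < p) ∧ (∀ i, b i < q) ∧
      ((puncturedMatrix k (p, q)).submatrix a b).det ∉
        ladderIdeal (puncturedMatrix k (p, q)) n p q ρ := by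
  choose d hd hρd hρd' using fun i : Fin r => hρ.exists_jump (l := q) (m := i) (by omega)
  let E : Matrix ℕ ℕ k := of fun i j => if ρ (j + 1) = ρ j + 1 ∧ i = ρ j then 1 else 0
  have hy : E p q = 0 := by simp [E, h0, h1]
  refine ⟨Fin.val, d, fun i => i.2.trans_le hr, hd, notMem_ladderIdeal_of_eval E hy ?_ ?_⟩
  · refine ladderIdeal_eq_bot fun l _ => ⟨_, (hρ.card_filter_range l).le, fun i j hj _ hjT => ?_⟩
    simp only [Finset.mem_filter, Finset.mem_range, hj, true_and] at hjT
    simp [E, hjT]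
  · rw [eval_det_puncturedMatrix E hy]
    have : E.submatrix Fin.val d = (1 : Matrix (Fin r) (Fin r) k) := by
      ext i j
      simp [E, hρd, hρd', one_apply, Fin.ext_iff]
    simp [this]

/-- The witness has ones at (ρ j, j) for the jumps j < c, at (m, q) and at (p, c). The last one is
invisible to the ladder, which contains row p only to the left of column c; so the first q columns
show just m nonzero ones. The bordered minor sees all m + 2 ones and is a unit. -/
theorem exists_bordered_minor_notMem_ladderIdeal [Nontrivial k] (hρ : IsRankFunction ρ) {m c : ℕ}
    (h0 : ρ q = m + 1) (h1 : ρ (q + 1) = m + 1) (hm : m + 1 ≤ p) (hc : ρ c = m)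
    (hc' : ρ (c + 1) = m + 1) :
    ∃ a b : Fin (m + 1) → ℕ, (∀ i, a i < p) ∧ (∀ i, b i < q) ∧
      ((puncturedMatrix k (p, q)).submatrix (Fin.snoc a p : Fin (m + 1 + 1) → ℕ)
        (Fin.snoc b q : Fin (m + 1 + 1) → ℕ)).det ∉
          ladderIdeal (puncturedMatrix k (p, q)) n p c (truncateRank ρ q m) := by
  have hcq : c < q := by
    by_contra! h
    have := hρ.mono h
    omega
  choose d hd hρd hρd' using fun i : Fin m => hρ.exists_jump (l := c) (m := i) (by omega)
  let E : Matrix ℕ ℕ k := of fun i j => if (ρ (j + 1) = ρ j + 1 ∧ j < c ∧ i = ρ j) ∨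
    (i = m ∧ j = q) ∨ (i = p ∧ j = c) then 1 else 0
  have hy : E p q = 0 := by
    have : p ≠ m := by omega
    simp [E, h0, h1, this, hcq.ne']
  have hrows (i : Fin (m + 1)) :
      (Fin.snoc (fun i : Fin m => (i : ℕ)) m : Fin (m + 1) → ℕ) i < p := by
    cases i using Fin.lastCases with
    | last => simpa using hm
    | cast i => simpa using i.2.trans (Nat.lt_of_succ_le hm)
  have hcols (i : Fin (m + 1)) : (Fin.snoc d c : Fin (m + 1) → ℕ) i < q := by
    cases i using Fin.lastCases with
    | last => simpa using hcq
    | cast i => simpa using (hd i).trans hcq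
  refine ⟨_, _, hrows, hcols, notMem_ladderIdeal_of_eval E hy ?_ ?_⟩
  · refine ladderIdeal_eq_bot fun l _ => ?_
    by_cases hl : l ≤ q
    · refine ⟨(Finset.range (min l c)).filter fun j => ρ (j + 1) = ρ j + 1, ?_,
        fun i j hj hi hjT => ?_⟩
      · rw [hρ.card_filter_range]
        have h2 := hρ.mono (min_le_left l c)
        have h3 := hρ.mono (min_le_right l c)
        simp only [truncateRank, hl, if_true]
        omega
      · simp only [Finset.mem_filter, Finset.mem_range, lt_min_iff, hj, true_and] at hjT
        have h2 : ¬ (ρ (j + 1) = ρ j + 1 ∧ j < c ∧ i = ρ j) := fun h => hjT ⟨h.2.1, h.1⟩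
        have h3 : ¬ (i = m ∧ j = q) := by omega
        have h4 : ¬ (i = p ∧ j = c) := by omega
        simp only [E, of_apply, h2, h3, h4, or_self, if_false]
    · refine ⟨insert q ((Finset.range c).filter fun j => ρ (j + 1) = ρ j + 1), ?_,
        fun i j hj hi hjT => ?_⟩
      · refine (Finset.card_insert_le _ _).trans ?_
        rw [hρ.card_filter_range]
        have h2 := hρ.mono (show q ≤ l by omega)
        simp only [truncateRank, hl, if_false]
        omega
      · simp only [Finset.mem_insert, Finset.mem_filter, Finset.mem_range, not_or] at hjT
        have h2 : ¬ (ρ (j + 1) = ρ j + 1 ∧ j < c ∧ i = ρ j) := fun h => hjT.2 ⟨h.2.1, h.1⟩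
        have h3 : ¬ (i = m ∧ j = q) := by omega
        have h4 : ¬ (i = p ∧ j = c) := by omega
        simp only [E, of_apply, h2, h3, h4, or_self, if_false]
  · rw [eval_det_puncturedMatrix E hy]
    intro hdet
    -- With the columns q and c exchanged the bordered submatrix is the identity, so the exchange
    -- costs only a sign.
    have hone : (E.submatrix (Fin.snoc (Fin.snoc (fun i : Fin m => (i : ℕ)) m : Fin (m + 1) → ℕ) p :
        Fin (m + 1 + 1) → ℕ) (Fin.snoc (Fin.snoc d q : Fin (m + 1) → ℕ) c :
          Fin (m + 1 + 1) → ℕ)) = (1 : Matrix (Fin (m + 1 + 1)) (Fin (m + 1 + 1)) k) := by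
      have hpm : p ≠ m := by omega
      ext i j
      cases i using Fin.lastCases with
      | last =>
        cases j using Fin.lastCases with
        | last => simp [E]
        | cast j =>
          rw [one_apply_ne (Fin.castSucc_lt_last j).ne']
          cases j using Fin.lastCases with
          | last => simp [E, hpm, hcq.ne', h0, h1]
          | cast j => simp [E, hρd, hρd', hd, (hd j).ne, show p ≠ j by omega, hpm]
      | cast i =>
        cases j using Fin.lastCases with
        | last =>
          rw [one_apply_ne (Fin.castSucc_lt_last i).ne]
          cases i using Fin.lastCases with
          | last => simp [E, hcq.ne, hpm.symm]
          | cast i => simp [E, hcq.ne, show (i : ℕ) ≠ p by omega]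
        | cast j =>
          cases i using Fin.lastCases with
          | last =>
            cases j using Fin.lastCases with
            | last => simp [E]
            | cast j =>
              rw [one_apply_ne (by simp [Fin.ext_iff]; omega)]
              simp [E, hρd, hρd', ((hd j).trans hcq).ne, (hd j).ne, show m ≠ j by omega]
          | cast i =>
            cases j using Fin.lastCases with
            | last =>
              rw [one_apply_ne (by simp [Fin.ext_iff]; omega)]
              simp [E, h0, h1, hcq.ne', i.2.ne]
            | cast j =>
              simp [E, hρd, hρd', hd, ((hd j).trans hcq).ne, (hd j).ne, one_apply, Fin.ext_iff]
    have hswap : (Fin.snoc (Fin.snoc d q : Fin (m + 1) → ℕ) c : Fin (m + 1 + 1) → ℕ) =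
        (Fin.snoc (Fin.snoc d c : Fin (m + 1) → ℕ) q : Fin (m + 1 + 1) → ℕ) ∘
          Equiv.swap (Fin.last m).castSucc (Fin.last (m + 1)) := by
      ext j
      cases j using Fin.lastCases with
      | last => simp
      | cast j =>
        cases j using Fin.lastCases with
        | last => simp
        | cast j =>
          rw [Function.comp, Equiv.swap_apply_of_ne_of_ne
            (by simp) (Fin.castSucc_lt_last _).ne]
          simp
    have := congrArg Matrix.det hone
    rw [hswap, det_one, ← Function.comp_id (Fin.snoc _ p), ← submatrix_submatrix, det_permute',
      hdet, mul_zero] at this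
    exact zero_ne_one this

theorem corner_notMem_ladderIdeal [Nontrivial k] {c : ℕ} (hp : 1 ≤ p) (hρ : 1 ≤ ρ n)
    (h : ((0, n - 1) : ℕ × ℕ) ≠ (p, q)) :
    X ⟨(0, n - 1), h⟩ ∉ ladderIdeal (puncturedMatrix k (p, q)) n p c ρ := by
  let E : Matrix ℕ ℕ k := of fun i j => if i = 0 ∧ j = n - 1 then 1 else 0
  have hy : E p q = 0 := by simp [E]; omega
  refine notMem_ladderIdeal_of_eval E hy (ladderIdeal_eq_bot fun l hl => ?_) (by simp [E])
  by_cases hln : l = n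
  · refine ⟨{n - 1}, by simpa [hln] using hρ, fun i j _ _ hj => ?_⟩
    simp only [Finset.mem_singleton] at hj
    simp [E, hj]
  · refine ⟨∅, by simp, fun i j hj _ _ => ?_⟩
    have : j ≠ n - 1 := by omega
    simp [E, this]

theorem linearExtensionAt_ladderIdeal (hq : q < n) {r : ℕ} (h0 : ρ q = r) (h1 : ρ (q + 1) = r) :
    linearExtensionAt (p, q) (ladderIdeal (puncturedMatrix k (p, q)) n p q ρ)
      (fun ab : {ab : (Fin r → ℕ) × (Fin r → ℕ) // (∀ i, ab.1 i < p) ∧ ∀ i, ab.2 i < q} =>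
        ((puncturedMatrix k (p, q)).submatrix ab.1.1 ab.1.2).det)
      (fun ab => ((puncturedMatrix k (p, q)).submatrix (Fin.snoc ab.1.1 p : Fin (r + 1) → ℕ)
          (Fin.snoc ab.1.2 q : Fin (r + 1) → ℕ)).det) =
      ladderIdeal (mvPolynomialX ℕ ℕ k) n p (q + 1) ρ := by
  rw [linearExtensionAt, map_includeNe_ladderIdeal le_rfl, ladderIdeal_succ_eq_sup hq h0 h1]
  congr 3
  ext1 ⟨⟨a, b⟩, ha, hb⟩
  have hdet (s : ℕ) (c d : Fin s → ℕ) :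
      includeNe k (p, q) ((puncturedMatrix k (p, q)).submatrix c d).det =
        (((puncturedMatrix k (p, q)).map (includeNe k (p, q)).toRingHom).submatrix c d).det :=
    RingHom.map_det (includeNe k (p, q)).toRingHom _
  have := det_eq_mul_add_det_of_eq
    (M := (mvPolynomialX ℕ ℕ k).submatrix (Fin.snoc a p : Fin (r + 1) → ℕ)
      (Fin.snoc b q : Fin (r + 1) → ℕ))
    (M' := ((puncturedMatrix k (p, q)).map (includeNe k (p, q)).toRingHom).submatrix
      (Fin.snoc a p : Fin (r + 1) → ℕ) (Fin.snoc b q : Fin (r + 1) → ℕ)) (by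
        intro i j hij
        refine (map_includeNe_puncturedMatrix _ _ fun h => ?_).symm
        simp only [Prod.mk.injEq] at h
        cases i using Fin.lastCases with
        | last =>
          cases j using Fin.lastCases with
          | last => exact hij rfl rfl
          | cast j => exact (hb j).ne (by simpa using h.2)
        | cast i => exact (ha i).ne (by simpa using h.1))
  rw [this, hdet, hdet]
  simp [puncturedMatrix_self, Function.comp_def]

/-- The hypothesis ranges over all rank functions and all c ≤ q because J is a ladder ideal that
stops at an earlier column and has truncated ranks. Primality and the radical property are kept
together for use in the same induction. -/
theorem isPrime_and_isRadical_ladderIdeal_succ [IsDomain k] (hq : q < n)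
    (ih : ∀ c ≤ q, ∀ ρ : ℕ → ℕ, IsRankFunction ρ →
      (ladderIdeal (mvPolynomialX ℕ ℕ k) n p c ρ).IsPrime ∧
      (1 ≤ ρ n → (ladderIdeal (mvPolynomialX ℕ ℕ k) n p c ρ ⊔
        Ideal.span {X (0, n - 1)}).IsRadical)) (hρ : IsRankFunction ρ) :
    (ladderIdeal (mvPolynomialX ℕ ℕ k) n p (q + 1) ρ).IsPrime ∧
      (1 ≤ ρ n → (ladderIdeal (mvPolynomialX ℕ ℕ k) n p (q + 1) ρ ⊔
        Ideal.span {X (0, n - 1)}).IsRadical) := by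
  have hρq := hρ.le_succ q
  have hρq' := hρ.succ_le q
  by_cases hjump : ρ (q + 1) = ρ q + 1
  · rw [ladderIdeal_succ_of_jump hq hjump]
    exact ih q le_rfl ρ hρ
  by_cases hlt : p < ρ (q + 1)
  · rw [ladderIdeal_succ_of_lt hq hlt]
    exact ih q le_rfl ρ hρ
  have h1 : ρ (q + 1) = ρ q := by omega
  set N := ladderIdeal (puncturedMatrix k (p, q)) n p q ρ with hN
  have hmapN : N.map (includeNe k (p, q)).toRingHom =
    ladderIdeal (mvPolynomialX ℕ ℕ k) n p q ρ := map_includeNe_ladderIdeal le_rfl ρ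
  have hNprime : N.IsPrime := Ideal.isPrime_of_map_of_leftInverse
    (leftInverse_killVariable (p, q)) (hmapN ▸ (ih q le_rfl ρ hρ).1)
  have hmapx (h : ((0, n - 1) : ℕ × ℕ) ≠ (p, q))
      (I : Ideal (MvPolynomial {i : ℕ × ℕ // i ≠ (p, q)} k)) :
      (I ⊔ Ideal.span {X ⟨(0, n - 1), h⟩}).map (includeNe k (p, q)).toRingHom =
        I.map (includeNe k (p, q)).toRingHom ⊔ Ideal.span {X (0, n - 1)} := by
    rw [Ideal.map_sup, Ideal.map_span, Set.image_singleton]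
    congr 3
    exact includeNe_X _ _
  rcases Nat.eq_zero_or_pos (ρ q) with h0 | h0
  · have hsucc : ladderIdeal (mvPolynomialX ℕ ℕ k) n p (q + 1) ρ =
        N.map (includeNe k (p, q)).toRingHom ⊔ Ideal.span {X (p, q)} := by
      rw [hmapN, ladderIdeal_succ_of_eq_zero hq h0 (h1.trans h0)]
      rfl
    constructor
    · rw [hsucc, map_includeNe_sup_span_X]
      infer_instance
    · intro hn
      have hne : ((0, n - 1) : ℕ × ℕ) ≠ (p, q) := by
        intro h
        simp only [Prod.mk.injEq] at h
        have : n = q + 1 := by omega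
        rw [this] at hn
        omega
      have := Ideal.isRadical_of_map_of_leftInverse (leftInverse_killVariable (p, q))
        (I := N ⊔ Ideal.span {X ⟨(0, n - 1), hne⟩}) (by
          rw [hmapx, hmapN]
          exact (ih q le_rfl ρ hρ).2 hn)
      rw [hsucc, sup_right_comm, ← hmapx hne, map_includeNe_sup_span_X]
      exact this.comap _
  · obtain ⟨m, hm⟩ : ∃ m, ρ q = m + 1 := ⟨ρ q - 1, by omega⟩
    obtain ⟨c, hcq, hc, hc'⟩ := hρ.exists_jump (m := m) (l := q) (by omega)
    have hmp : m + 1 ≤ p := by omega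
    set J := ladderIdeal (puncturedMatrix k (p, q)) n p c (truncateRank ρ q m) with hJdef
    have hρ' := hρ.truncateRank (h1.trans hm)
    have ihc := ih c hcq.le _ hρ'
    have hmapJ : J.map (includeNe k (p, q)).toRingHom = ladderIdeal (mvPolynomialX ℕ ℕ k) n p c
      (truncateRank ρ q m) := map_includeNe_ladderIdeal hcq.le _
    have hJprime : J.IsPrime := Ideal.isPrime_of_map_of_leftInverse
      (leftInverse_killVariable (p, q)) (hmapJ ▸ ihc.1)
    have hJ := ladderIdeal_truncateRank (M := puncturedMatrix k (p, q)) (p := p) hq hρ hm hc hc'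
    have hE := linearExtensionAt_ladderIdeal (k := k) (p := p) hq hm (h1.trans hm)
    let π : MvPolynomial {i : ℕ × ℕ // i ≠ (p, q)} k →+* FractionRing (_ ⧸ N) :=
      (algebraMap (_ ⧸ N) (FractionRing (_ ⧸ N))).comp (Ideal.Quotient.mk N)
    have hker : RingHom.ker π = N := by
      rw [RingHom.ker_comp_of_injective _ (IsFractionRing.injective (_ ⧸ N) _), Ideal.mk_ker]
    have hπdet (s : ℕ) (a b : Fin s → ℕ) : π ((puncturedMatrix k (p, q)).submatrix a b).det =
        (((puncturedMatrix k (p, q)).map π).submatrix a b).det := RingHom.map_det π _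
    obtain ⟨a₀, b₀, ha₀, hb₀, h₀⟩ := exists_minor_notMem_ladderIdeal (k := k) (n := n) hρ hm
      (h1.trans hm) hmp
    -- Over the fraction field of the quotient by N the matrix with a hole satisfies the rank
    -- conditions for r = m + 1; the completed entry z is the common root of the linear polynomials.
    obtain ⟨z, hz⟩ := exists_rank_completion ((puncturedMatrix k (p, q)).map π) (p := p) (q := q)
      (by simp [puncturedMatrix_self]) ha₀ hb₀ (by
        rw [← hπdet]
        exact fun h => h₀ (hker ▸ h : _ ∈ N)) (by
        intro a b ha hb hab
        rw [← hπdet, ← RingHom.mem_ker, hker]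
        rcases hab with hab | hab
        · exact det_mem_ladderIdeal (l := q + 1) hq (by omega)
            (fun i => Nat.lt_succ_of_le (hb i)) fun i => Or.inl (hab i)
        · refine det_mem_ladderIdeal (l := q) hq.le (by omega) hab fun i => ?_
          have := ha i
          omega)
    have hz' (ab : {ab : (Fin (m + 1) → ℕ) × (Fin (m + 1) → ℕ) //
        (∀ i, ab.1 i < p) ∧ ∀ i, ab.2 i < q}) :
        z * π ((puncturedMatrix k (p, q)).submatrix ab.1.1 ab.1.2).det +
          π ((puncturedMatrix k (p, q)).submatrix (Fin.snoc ab.1.1 p : Fin (m + 1 + 1) → ℕ)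
            (Fin.snoc ab.1.2 q : Fin (m + 1 + 1) → ℕ)).det = 0 := by
      rw [hπdet, hπdet]
      exact hz _ _ ab.2.1 ab.2.2
    obtain ⟨a₁, b₁, ha₁, hb₁, h₁⟩ := exists_bordered_minor_notMem_ladderIdeal (k := k) (n := n) hρ
      hm (h1.trans hm) hmp hc hc'
    rw [← hE]
    refine ⟨isPrime_linearExtensionAt hker hJ hJprime hz' (i := ⟨(a₁, b₁), ha₁, hb₁⟩) h₁,
      fun hn => ?_⟩
    have hne : ((0, n - 1) : ℕ × ℕ) ≠ (p, q) := by
      intro h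
      simp only [Prod.mk.injEq] at h
      omega
    have hn' : 1 ≤ truncateRank ρ q m n := by
      simp only [truncateRank, show ¬ n ≤ q by omega, if_false]
      exact hn
    have := isRadical_linearExtensionAt_sup hker hJ hJprime hz'
      (corner_notMem_ladderIdeal (by omega) hn' hne)
      (Ideal.isRadical_of_map_of_leftInverse (leftInverse_killVariable (p, q)) (by
        rw [hmapx, hmapN]
        exact (ih q le_rfl ρ hρ).2 hn))
      (Ideal.isRadical_of_map_of_leftInverse (leftInverse_killVariable (p, q)) (by
        rw [hmapx, hmapJ]
        exact ihc.2 hn'))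
    rwa [includeNe_X] at this

theorem isPrime_and_isRadical_ladderIdeal [IsDomain k] (n p : ℕ) : ∀ q ≤ n, ∀ ρ : ℕ → ℕ,
    IsRankFunction ρ → (ladderIdeal (mvPolynomialX ℕ ℕ k) n p q ρ).IsPrime ∧
      (1 ≤ ρ n → (ladderIdeal (mvPolynomialX ℕ ℕ k) n p q ρ ⊔
        Ideal.span {X (0, n - 1)}).IsRadical) := by
  induction p with
  | zero =>
    intro q
    induction q using Nat.strong_induction_on with
    | _ q ih =>
      intro hq ρ hρ
      rcases q with _ | q
      · rw [ladderIdeal_zero_zero]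
        refine ⟨Ideal.isPrime_bot, fun _ => ?_⟩
        rw [← Ideal.map_bot (f := (includeNe k (0, n - 1)).toRingHom), map_includeNe_sup_span_X]
        exact (Ideal.isPrime_bot.isRadical).comap _
      · exact isPrime_and_isRadical_ladderIdeal_succ hq
          (fun c hc ρ hρ => ih c (by omega) (by omega) ρ hρ) hρ
  | succ p ihp =>
    intro q
    induction q using Nat.strong_induction_on with
    | _ q ih =>
      intro hq ρ hρ
      rcases q with _ | q
      · rw [ladderIdeal_succ_zero]
        exact ihp n le_rfl ρ hρ
      · exact isPrime_and_isRadical_ladderIdeal_succ hq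
          (fun c hc ρ hρ => ih c (by omega) (by omega) ρ hρ) hρ

/-- For l ≤ r the minors have more columns than are available and vanish; for l > r they are (r +
1)-minors. With q = 0 row m is excluded, as a column index below l = 0 cannot exist. -/
theorem ladderIdeal_eq_minorsIdeal {A : Type*} [CommRing A] (M : Matrix ℕ ℕ A) (m n r : ℕ) :
    ladderIdeal M n m 0 (fun j => min j r) = minorsIdeal
      (M.submatrix (Fin.val : Fin m → ℕ) (Fin.val : Fin n → ℕ)) (r + 1) := by
  apply le_antisymm
  · rw [ladderIdeal_le_iff]
    rintro l s hl rfl a b hb ha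
    have ha' (i) : a i < m := by
      have h1 := ha i
      have h2 := hb i
      omega
    rcases Nat.lt_or_ge l (min l r + 1) with h | h
    · rw [← det_transpose, transpose_submatrix, det_submatrix_eq_zero_of_card_lt h b a hb]
      exact zero_mem _
    · have := det_submatrix_mem_minorsIdeal (s := r + 1)
        (M.submatrix (Fin.val : Fin m → ℕ) (Fin.val : Fin n → ℕ))
        (by rw [Fintype.card_fin]; omega) (fun i => ⟨a i, ha' i⟩)
        (fun i => ⟨b i, (hb i).trans_le hl⟩)
      exact this
  · rw [minorsIdeal_le_iff]
    intro a b
    by_cases h : r < n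
    · exact det_mem_ladderIdeal (l := n) le_rfl (by rw [min_eq_right h.le]) (fun i => (b i).2)
        fun i => Or.inl (a i).2
    · rw [submatrix_submatrix, ← det_transpose, transpose_submatrix,
        det_submatrix_eq_zero_of_card_lt (m := n) (by omega) (Fin.val ∘ b) (Fin.val ∘ a)
          fun i => (b i).2]
      exact zero_mem _

/-- The inclusion of the polynomials in the entries of an `m × n` matrix. -/
noncomputable def includeFin (k : Type*) [CommRing k] (m n : ℕ) :
    MvPolynomial (Fin m × Fin n) k →ₐ[k] MvPolynomial (ℕ × ℕ) k :=
  rename (Prod.map Fin.val Fin.val)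

theorem exists_leftInverse_includeFin (m n : ℕ) :
    ∃ g : MvPolynomial (ℕ × ℕ) k →+* MvPolynomial (Fin m × Fin n) k,
      Function.LeftInverse g (includeFin k m n).toRingHom := by
  have hinj : Function.Injective (Prod.map Fin.val Fin.val : Fin m × Fin n → ℕ × ℕ) :=
    Fin.val_injective.prodMap Fin.val_injective
  exact ⟨(killCompl hinj).toRingHom, killCompl_rename_app hinj⟩

theorem map_includeFin_minorsIdeal (m n r : ℕ) :
    (minorsIdeal (mvPolynomialX (Fin m) (Fin n) k) (r + 1)).map (includeFin k m n).toRingHom =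
      ladderIdeal (mvPolynomialX ℕ ℕ k) n m 0 (fun j => min j r) := by
  rw [ladderIdeal_eq_minorsIdeal, map_minorsIdeal]
  congr 1
  ext1 i j
  simp [includeFin]

theorem isRankFunction_min (r : ℕ) : IsRankFunction fun j => min j r :=
  ⟨by simp, fun j => by omega, fun j => by omega⟩

/-- Determinantal ideals of a generic matrix over a domain are prime. -/
theorem isPrime_minorsIdeal [IsDomain k] (m n r : ℕ) :
    (minorsIdeal (mvPolynomialX (Fin m) (Fin n) k) (r + 1)).IsPrime := by
  obtain ⟨g, hg⟩ := exists_leftInverse_includeFin (k := k) m n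
  apply Ideal.isPrime_of_map_of_leftInverse hg
  rw [map_includeFin_minorsIdeal]
  exact (isPrime_and_isRadical_ladderIdeal n m 0 (Nat.zero_le _) _ (isRankFunction_min r)).1

theorem isRadical_minorsIdeal_sup [IsDomain k] (m n r : ℕ) (hr : 1 ≤ r) :
    (minorsIdeal (mvPolynomialX (Fin (m + 1)) (Fin (n + 1)) k) (r + 1) ⊔
      Ideal.span {X (0, Fin.last n)}).IsRadical := by
  obtain ⟨g, hg⟩ := exists_leftInverse_includeFin (k := k) (m + 1) (n + 1)
  apply Ideal.isRadical_of_map_of_leftInverse hg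
  rw [Ideal.map_sup, map_includeFin_minorsIdeal, Ideal.map_span, Set.image_singleton]
  have := (isPrime_and_isRadical_ladderIdeal (k := k) (n + 1) (m + 1) 0 (Nat.zero_le _) _
    (isRankFunction_min r)).2 (by simp; omega)
  have hx : (includeFin k (m + 1) (n + 1)).toRingHom (X (0, Fin.last n)) = X (0, n) := by
    simp [includeFin]
  rw [hx]
  exact this

end LadderPrime

/-! ### Rank-bounded matrices determined by some rows and columns. -/

section SchurComplement

open Matrix

variable {A B : Type*} [CommRing A] [CommRing B] {α β ι : Type*} [Fintype ι] [DecidableEq ι]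

/-- The matrix of rank at most `#ι` that agrees with `M` in the rows `a` and the columns `b`,
provided that the submatrix with these rows and columns is invertible. -/
noncomputable def crossExtension (M : Matrix α β A) (a : ι → α) (b : ι → β) : Matrix α β A :=
  M.submatrix id b * (M.submatrix a b)⁻¹ * M.submatrix a id

theorem crossExtension_congr {M M' : Matrix α β A} {a : ι → α} {b : ι → β}
    (h : ∀ i j, i ∈ Set.range a ∨ j ∈ Set.range b → M i j = M' i j) :
    crossExtension M a b = crossExtension M' a b := by
  have h1 : M.submatrix id b = M'.submatrix id b := by ext i j; exact h _ _ (Or.inr ⟨j, rfl⟩)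
  have h2 : M.submatrix a b = M'.submatrix a b := by ext i j; exact h _ _ (Or.inr ⟨j, rfl⟩)
  have h3 : M.submatrix a id = M'.submatrix a id := by ext i j; exact h _ _ (Or.inl ⟨i, rfl⟩)
  rw [crossExtension, crossExtension, h1, h2, h3]

theorem crossExtension_apply {M : Matrix α β A} {a : ι → α} {b : ι → β}
    (hu : IsUnit (M.submatrix a b).det) {i : α} {j : β}
    (h : i ∈ Set.range a ∨ j ∈ Set.range b) : crossExtension M a b i j = M i j := by
  rcases h with ⟨i, rfl⟩ | ⟨j, rfl⟩
  · have : (crossExtension M a b).submatrix a id = M.submatrix a id := by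
      rw [crossExtension, ← submatrix_mul_equiv _ _ a (Equiv.refl ι) id,
        ← submatrix_mul_equiv _ _ a (Equiv.refl ι) (Equiv.refl ι)]
      simp [mul_nonsing_inv _ hu]
    exact congrFun (congrFun this i) j
  · have : (crossExtension M a b).submatrix id b = M.submatrix id b := by
      rw [crossExtension, Matrix.mul_assoc, ← submatrix_mul_equiv _ _ id (Equiv.refl ι) b,
        ← submatrix_mul_equiv _ _ (Equiv.refl ι) (Equiv.refl ι) b]
      simp [nonsing_inv_mul _ hu]
    exact congrFun (congrFun this i) j

theorem map_crossExtension (f : A →+* B) {M : Matrix α β A} {a : ι → α} {b : ι → β}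
    (hu : IsUnit (M.submatrix a b).det) :
    (crossExtension M a b).map f = crossExtension (M.map f) a b := by
  have hinv : (M.submatrix a b)⁻¹.map f = ((M.map f).submatrix a b)⁻¹ := by
    refine (inv_eq_right_inv ?_).symm
    have := congrArg (fun N => N.map f) (mul_nonsing_inv _ hu)
    rw [submatrix_map]
    simpa [Matrix.map_mul] using this
  rw [crossExtension, crossExtension, Matrix.map_mul, Matrix.map_mul, hinv]
  rfl

end SchurComplement

/-! ### Localization of a determinantal ring at a minor. -/

section Localization

open Matrix MvPolynomial

/-- The quotient of the polynomial ring in the entries of a generic matrix by the ideal of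
`t`-minors. -/
abbrev MinorQuotient (k : Type*) [CommRing k] (α β : Type*) (t : ℕ) : Type _ :=
  MvPolynomial (α × β) k ⧸ minorsIdeal (mvPolynomialX α β k) t

/-- The image of the generic matrix in `MinorQuotient k α β t`. -/
noncomputable def quotientMatrix (k : Type*) [CommRing k] (α β : Type*) (t : ℕ) :
    Matrix α β (MinorQuotient k α β t) :=
  (mvPolynomialX α β k).map (Ideal.Quotient.mk _)

variable (k : Type*) [CommRing k] {α β ι : Type*} [Fintype ι] [DecidableEq ι]

/-- The positions that lie in one of the rows `a` or in one of the columns `b`. -/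
abbrev CrossIndex (a : ι → α) (b : ι → β) : Type _ :=
  {ij : α × β // ij.1 ∈ Set.range a ∨ ij.2 ∈ Set.range b}

open Classical in
/-- The generic matrix with zeros outside of the rows `a` and the columns `b`. -/
noncomputable def crossMatrix (a : ι → α) (b : ι → β) :
    Matrix α β (MvPolynomial (CrossIndex a b) k) :=
  of fun i j => if h : i ∈ Set.range a ∨ j ∈ Set.range b then X ⟨(i, j), h⟩ else 0

/-- The polynomial ring in the entries of the rows `a` and the columns `b`, localized at the minor
with these rows and columns. -/
abbrev CrossRing (a : ι → α) (b : ι → β) : Type _ :=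
  Localization.Away ((crossMatrix k a b).submatrix a b).det

/-- The positions outside of the rows `a` and the columns `b`. -/
abbrev OffCrossQuotient (a : ι → α) (b : ι → β) (s : ℕ) : Type _ :=
  MinorQuotient (CrossRing k a b) {i // i ∉ Set.range a} {j // j ∉ Set.range b} s

/-- The localization of a determinantal ring at a minor. -/
abbrev MinorLocalization (a : ι → α) (b : ι → β) (t : ℕ) : Type _ :=
  Localization.Away ((quotientMatrix k α β t).submatrix a b).det

variable (a : ι → α) (b : ι → β) (s : ℕ)

/-- The structure map of `OffCrossQuotient`. -/
noncomputable def crossToQuotient :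
    MvPolynomial (CrossIndex a b) k →+* OffCrossQuotient k a b s :=
  (Ideal.Quotient.mk _).comp (C.comp (algebraMap _ (CrossRing k a b)))

theorem isUnit_det_map_crossToQuotient :
    IsUnit (((crossMatrix k a b).map (crossToQuotient k a b s)).submatrix a b).det := by
  have := (IsLocalization.Away.algebraMap_isUnit (S := CrossRing k a b)
    ((crossMatrix k a b).submatrix a b).det).map ((Ideal.Quotient.mk
      (minorsIdeal (mvPolynomialX {i // i ∉ Set.range a} {j // j ∉ Set.range b}
        (CrossRing k a b)) s)).comp C)
  rw [submatrix_map, ← RingHom.mapMatrix_apply, ← RingHom.map_det]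
  exact this

open Classical in
/-- The matrix over `OffCrossQuotient` that corresponds to the generic matrix. -/
noncomputable def offCrossMatrix : Matrix α β (OffCrossQuotient k a b s) :=
  (of fun i j => if h : i ∉ Set.range a ∧ j ∉ Set.range b then
    quotientMatrix (CrossRing k a b) _ _ s ⟨i, h.1⟩ ⟨j, h.2⟩ else 0) +
  crossExtension ((crossMatrix k a b).map (crossToQuotient k a b s)) a b

theorem offCrossMatrix_of_mem {i : α} {j : β} (h : i ∈ Set.range a ∨ j ∈ Set.range b) :
    offCrossMatrix k a b s i j = crossToQuotient k a b s (X ⟨(i, j), h⟩) := by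
  have h' : ¬ (i ∉ Set.range a ∧ j ∉ Set.range b) := by tauto
  rw [offCrossMatrix, Matrix.add_apply,
    crossExtension_apply (isUnit_det_map_crossToQuotient k a b s) h]
  simp only [of_apply, h', dif_neg, not_false_eq_true, zero_add, Matrix.map_apply, crossMatrix, h,
    dif_pos]

/-- The matrix is a sum of the generic matrix Y padded by zeros and a product that factors through
`ι`, so `minorsIdeal_add_mul_le` reduces to s-minors of the padded Y. Such a minor has a zero row or
column, or is an s-minor of Y. -/
theorem minorsIdeal_offCrossMatrix :
    minorsIdeal (offCrossMatrix k a b s) (s + Fintype.card ι) = ⊥ := by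
  classical
  obtain ⟨e⟩ : Nonempty (Fin (Fintype.card ι) ≃ ι) := ⟨(Fintype.equivFin ι).symm⟩
  set M := (crossMatrix k a b).map (crossToQuotient k a b s)
  have hM : crossExtension M a b = ((M.submatrix id b * (M.submatrix a b)⁻¹).submatrix id e) *
      (M.submatrix a id).submatrix e id := by
    rw [submatrix_mul_equiv _ _ id e id, submatrix_id_id]
    rfl
  rw [offCrossMatrix, hM, eq_bot_iff]
  refine (minorsIdeal_add_mul_le _ _ _ s).trans (minorsIdeal_le_iff.mpr fun c d => ?_)
  rw [Ideal.mem_bot]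
  by_cases hc : ∃ i, c i ∈ Set.range a
  · obtain ⟨i, hi⟩ := hc
    exact det_eq_zero_of_row_eq_zero i fun j => by
      rw [submatrix_apply, of_apply, dif_neg fun h => h.1 hi]
  by_cases hd : ∃ j, d j ∈ Set.range b
  · obtain ⟨j, hj⟩ := hd
    exact det_eq_zero_of_column_eq_zero j fun i => by
      rw [submatrix_apply, of_apply, dif_neg fun h => h.2 hj]
  push Not at hc hd
  have : ((quotientMatrix (CrossRing k a b) {i // i ∉ Set.range a} {j // j ∉ Set.range b}
      s).submatrix (fun i => ⟨c i, hc i⟩) fun j => ⟨d j, hd j⟩).det = 0 := by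
    rw [quotientMatrix, submatrix_map, ← RingHom.mapMatrix_apply, ← RingHom.map_det,
      Ideal.Quotient.eq_zero_iff_mem]
    exact Ideal.subset_span ⟨_, _, rfl⟩
  rw [← this]
  congr 1
  ext i j
  rw [submatrix_apply, of_apply, dif_pos ⟨hc i, hd j⟩]
  rfl

/-- The map from a determinantal ring to `OffCrossQuotient`. -/
noncomputable def toOffCross :
    MinorQuotient k α β (s + Fintype.card ι) →+* OffCrossQuotient k a b s :=
  Ideal.Quotient.lift _ (aeval fun ij => offCrossMatrix k a b s ij.1 ij.2 :
    MvPolynomial (α × β) k →ₐ[k] OffCrossQuotient k a b s).toRingHom fun f hf => by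
      have h1 := Ideal.mem_map_of_mem (aeval fun ij => offCrossMatrix k a b s ij.1 ij.2 :
        MvPolynomial (α × β) k →ₐ[k] OffCrossQuotient k a b s).toRingHom hf
      have h2 : (mvPolynomialX α β k).map (aeval fun ij => offCrossMatrix k a b s ij.1 ij.2 :
          MvPolynomial (α × β) k →ₐ[k] OffCrossQuotient k a b s).toRingHom =
            offCrossMatrix k a b s := by
        ext i j
        simp
      rwa [map_minorsIdeal, h2, minorsIdeal_offCrossMatrix, Ideal.mem_bot] at h1

theorem toOffCross_quotientMatrix (i : α) (j : β) :
    toOffCross k a b s (quotientMatrix k α β _ i j) = offCrossMatrix k a b s i j := by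
  simp [toOffCross, quotientMatrix]

theorem map_toOffCross_quotientMatrix :
    (quotientMatrix k α β _).map (toOffCross k a b s) = offCrossMatrix k a b s := by
  ext i j
  exact toOffCross_quotientMatrix k a b s i j

theorem offCrossMatrix_submatrix : (offCrossMatrix k a b s).submatrix a b =
    ((crossMatrix k a b).map (crossToQuotient k a b s)).submatrix a b := by
  ext i j
  simp [offCrossMatrix_of_mem k a b s (Or.inl (Set.mem_range_self i)), crossMatrix]

theorem toOffCross_det :
    toOffCross k a b s ((quotientMatrix k α β _).submatrix a b).det =
      (((crossMatrix k a b).map (crossToQuotient k a b s)).submatrix a b).det := by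
  rw [RingHom.map_det, RingHom.mapMatrix_apply, ← submatrix_map, map_toOffCross_quotientMatrix,
    offCrossMatrix_submatrix]

/-- The map from the localization of a determinantal ring to `OffCrossQuotient`. -/
noncomputable def localizationToOffCross :
    MinorLocalization k a b (s + Fintype.card ι) →+* OffCrossQuotient k a b s :=
  IsLocalization.Away.lift (g := toOffCross k a b s) _
    (toOffCross_det k a b s ▸ isUnit_det_map_crossToQuotient k a b s)

/-- The image of the generic matrix in the localization of a determinantal ring. -/
noncomputable def localizedMatrix (t : ℕ) : Matrix α β (MinorLocalization k a b t) :=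
  (quotientMatrix k α β t).map (algebraMap _ _)

theorem isUnit_det_localizedMatrix (t : ℕ) :
    IsUnit ((localizedMatrix k a b t).submatrix a b).det := by
  rw [localizedMatrix, submatrix_map, ← RingHom.mapMatrix_apply, ← RingHom.map_det]
  exact IsLocalization.Away.algebraMap_isUnit _

/-- The map from `CrossRing` to the localization of a determinantal ring. -/
noncomputable def crossToLocalization (t : ℕ) : CrossRing k a b →+* MinorLocalization k a b t :=
  IsLocalization.Away.lift ((crossMatrix k a b).submatrix a b).det
    (g := (aeval fun ij => localizedMatrix k a b t ij.1.1 ij.1.2 :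
      MvPolynomial (CrossIndex a b) k →ₐ[k] _).toRingHom) (by
      have h : ((crossMatrix k a b).submatrix a b).map (aeval fun ij : CrossIndex a b =>
          localizedMatrix k a b t ij.1.1 ij.1.2).toRingHom =
            (localizedMatrix k a b t).submatrix a b := by
        ext i j
        simp [crossMatrix]
      rw [RingHom.map_det, RingHom.mapMatrix_apply, h]
      exact isUnit_det_localizedMatrix k a b t)

theorem minorsIdeal_localizedMatrix (t : ℕ) : minorsIdeal (localizedMatrix k a b t) t = ⊥ := by
  have : minorsIdeal (quotientMatrix k α β t) t = ⊥ := by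
    rw [quotientMatrix, ← map_minorsIdeal, Ideal.map_quotient_self]
  rw [localizedMatrix, ← map_minorsIdeal, this, Ideal.map_bot]

/-- The matrix over the localization of a determinantal ring that corresponds to the generic matrix
of `OffCrossQuotient`. -/
noncomputable def localizedSchur (t : ℕ) : Matrix α β (MinorLocalization k a b t) :=
  localizedMatrix k a b t - crossExtension (localizedMatrix k a b t) a b

/-- The map from the polynomial ring over `CrossRing` to the localization of a determinantal
ring. -/
noncomputable def offCrossEval (t : ℕ) : MvPolynomial ({i // i ∉ Set.range a} ×
    {j // j ∉ Set.range b}) (CrossRing k a b) →+* MinorLocalization k a b t :=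
  eval₂Hom (crossToLocalization k a b t) fun ij => localizedSchur k a b t ij.1 ij.2

/-- By `det_bordered_submatrix`, an s-minor of the Schur complement times the inverted minor is a
minor of X of the size that is killed. -/
theorem map_offCrossEval_minorsIdeal :
    (minorsIdeal (mvPolynomialX {i // i ∉ Set.range a} {j // j ∉ Set.range b}
      (CrossRing k a b)) s).map (offCrossEval k a b (s + Fintype.card ι)) = ⊥ := by
  rw [map_minorsIdeal, eq_bot_iff, minorsIdeal_le_iff]
  intro c d
  have h3 := det_bordered_submatrix (localizedMatrix k a b (s + Fintype.card ι)) a b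
    (isUnit_det_localizedMatrix k a b _) (fun i => (c i).1) (fun i => (d i).1)
  have h4 := det_submatrix_mem_minorsIdeal (localizedMatrix k a b (s + Fintype.card ι))
    (ι := ι ⊕ Fin s) (s := s + Fintype.card ι) (by simp [add_comm])
    (Sum.elim a (fun i => (c i).1)) (Sum.elim b (fun i => (d i).1))
  rw [minorsIdeal_localizedMatrix, Ideal.mem_bot, h3,
    IsUnit.mul_right_eq_zero (isUnit_det_localizedMatrix k a b _)] at h4
  rw [Ideal.mem_bot, ← h4]
  congr 1
  ext i j
  simp [offCrossEval, localizedSchur, crossExtension]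

/-- The inverse of `localizationToOffCross`. -/
noncomputable def offCrossToLocalization :
    OffCrossQuotient k a b s →+* MinorLocalization k a b (s + Fintype.card ι) :=
  Ideal.Quotient.lift _ (offCrossEval k a b _) fun f hf => by
    have h1 := Ideal.mem_map_of_mem (offCrossEval k a b (s + Fintype.card ι)) hf
    rwa [map_offCrossEval_minorsIdeal] at h1

theorem offCrossToLocalization_crossToQuotient (f : MvPolynomial (CrossIndex a b) k) :
    offCrossToLocalization k a b s (crossToQuotient k a b s f) =
      aeval (fun ij : CrossIndex a b => localizedMatrix k a b (s + Fintype.card ι)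
        ij.1.1 ij.1.2) f := by
  simp only [offCrossToLocalization, crossToQuotient, RingHom.comp_apply, Ideal.Quotient.lift_mk,
    offCrossEval, eval₂Hom_C, crossToLocalization, IsLocalization.Away.lift_eq]
  rfl

theorem localizationToOffCross_localizedMatrix (i : α) (j : β) :
    localizationToOffCross k a b s (localizedMatrix k a b _ i j) = offCrossMatrix k a b s i j := by
  simp [localizationToOffCross, localizedMatrix, IsLocalization.Away.lift_eq,
    toOffCross_quotientMatrix]

theorem map_localizationToOffCross_localizedMatrix :
    (localizedMatrix k a b _).map (localizationToOffCross k a b s) = offCrossMatrix k a b s := by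
  ext i j
  exact localizationToOffCross_localizedMatrix k a b s i j

theorem crossExtension_offCrossMatrix :
    crossExtension (offCrossMatrix k a b s) a b =
      crossExtension ((crossMatrix k a b).map (crossToQuotient k a b s)) a b :=
  crossExtension_congr fun i j h => by
    rw [offCrossMatrix_of_mem k a b s h]
    simp only [Matrix.map_apply, crossMatrix, of_apply, h, dif_pos]

theorem map_offCrossToLocalization_crossExtension :
    (crossExtension ((crossMatrix k a b).map (crossToQuotient k a b s)) a b).map
      (offCrossToLocalization k a b s) =
        crossExtension (localizedMatrix k a b (s + Fintype.card ι)) a b := by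
  rw [map_crossExtension _ (isUnit_det_map_crossToQuotient k a b s)]
  refine crossExtension_congr fun i j h => ?_
  rw [Matrix.map_apply, Matrix.map_apply, offCrossToLocalization_crossToQuotient, crossMatrix,
    of_apply, dif_pos h, aeval_X]

theorem localizationToOffCross_algebraMap (c : k) :
    localizationToOffCross k a b s (algebraMap k _ c) = algebraMap k _ c := by
  rw [IsScalarTower.algebraMap_apply k (MinorQuotient k α β (s + Fintype.card ι))
    (MinorLocalization k a b _), localizationToOffCross, IsLocalization.Away.lift_eq]
  exact AlgHom.commutes (aeval fun ij => offCrossMatrix k a b s ij.1 ij.2 :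
    MvPolynomial (α × β) k →ₐ[k] OffCrossQuotient k a b s) c

theorem crossToQuotient_C (c : k) : crossToQuotient k a b s (C c) = algebraMap k _ c := by
  rw [IsScalarTower.algebraMap_apply k (CrossRing k a b) (OffCrossQuotient k a b s),
    IsScalarTower.algebraMap_apply k (MvPolynomial (CrossIndex a b) k) (CrossRing k a b)]
  rfl

theorem offCrossToLocalization_quotientMatrix (i : {i // i ∉ Set.range a})
    (j : {j // j ∉ Set.range b}) : offCrossToLocalization k a b s
      (quotientMatrix (CrossRing k a b) _ _ s i j) = localizedSchur k a b _ i j := by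
  change offCrossEval k a b _ (X (i, j)) = _
  simp [offCrossEval]

theorem offCrossToLocalization_offCrossMatrix (i : α) (j : β) :
    offCrossToLocalization k a b s (offCrossMatrix k a b s i j) = localizedMatrix k a b _ i j := by
  by_cases h : i ∈ Set.range a ∨ j ∈ Set.range b
  · rw [offCrossMatrix_of_mem k a b s h, offCrossToLocalization_crossToQuotient, aeval_X]
  · have h' : i ∉ Set.range a ∧ j ∉ Set.range b := by tauto
    have h1 := congrFun (congrFun (map_offCrossToLocalization_crossExtension k a b s) i) j
    rw [Matrix.map_apply] at h1
    rw [offCrossMatrix, Matrix.add_apply, of_apply, dif_pos h', map_add, h1]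
    rw [offCrossToLocalization_quotientMatrix, localizedSchur, Matrix.sub_apply, sub_add_cancel]

theorem offCrossToLocalization_comp :
    (offCrossToLocalization k a b s).comp (localizationToOffCross k a b s) = RingHom.id _ := by
  refine IsLocalization.ringHom_ext
    (Submonoid.powers ((quotientMatrix k α β (s + Fintype.card ι)).submatrix a b).det) ?_
  refine Ideal.Quotient.ringHom_ext (MvPolynomial.ringHom_ext (fun c => ?_) fun ij => ?_)
  · change offCrossToLocalization k a b s (localizationToOffCross k a b s (algebraMap k _ c)) =
      algebraMap k _ c
    rw [localizationToOffCross_algebraMap, ← crossToQuotient_C,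
      offCrossToLocalization_crossToQuotient]
    exact AlgHom.commutes _ c
  · change offCrossToLocalization k a b s (localizationToOffCross k a b s
      (localizedMatrix k a b _ ij.1 ij.2)) = localizedMatrix k a b _ ij.1 ij.2
    rw [localizationToOffCross_localizedMatrix, offCrossToLocalization_offCrossMatrix]

theorem localizationToOffCross_comp :
    (localizationToOffCross k a b s).comp (offCrossToLocalization k a b s) = RingHom.id _ := by
  have hcross : ((localizationToOffCross k a b s).comp (offCrossToLocalization k a b s)).comp
      (crossToQuotient k a b s) = crossToQuotient k a b s := by
    refine MvPolynomial.ringHom_ext (fun c => ?_) fun ij => ?_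
    · rw [RingHom.comp_apply, RingHom.comp_apply, offCrossToLocalization_crossToQuotient,
        crossToQuotient_C, ← localizationToOffCross_algebraMap]
      congr 1
      exact AlgHom.commutes _ c
    · rw [RingHom.comp_apply, RingHom.comp_apply, offCrossToLocalization_crossToQuotient,
        aeval_X, localizationToOffCross_localizedMatrix, offCrossMatrix_of_mem k a b s ij.2]
  refine Ideal.Quotient.ringHom_ext (MvPolynomial.ringHom_ext (fun c => ?_) fun ij => ?_)
  · refine RingHom.congr_fun (f := (((localizationToOffCross k a b s).comp
      (offCrossToLocalization k a b s)).comp (Ideal.Quotient.mk _)).comp C)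
      (g := (Ideal.Quotient.mk _).comp C) ?_ c
    exact IsLocalization.ringHom_ext
      (Submonoid.powers ((crossMatrix k a b).submatrix a b).det) hcross
  -- Off the cross, Y is recovered as X minus its cross extension, which depends only on the cross
  -- and commutes with ring homomorphisms.
  · have h2 := congrFun (congrFun (map_crossExtension (localizationToOffCross k a b s)
      (isUnit_det_localizedMatrix k a b _)) ij.1.1) ij.2.1
    change localizationToOffCross k a b s (offCrossToLocalization k a b s
      (quotientMatrix (CrossRing k a b) _ _ s ij.1 ij.2)) =
        quotientMatrix (CrossRing k a b) _ _ s ij.1 ij.2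
    rw [Matrix.map_apply, map_localizationToOffCross_localizedMatrix,
      crossExtension_offCrossMatrix] at h2
    rw [offCrossToLocalization_quotientMatrix, localizedSchur, Matrix.sub_apply, map_sub,
      localizationToOffCross_localizedMatrix, h2,
      offCrossMatrix, Matrix.add_apply, add_sub_cancel_right, of_apply,
      dif_pos ⟨ij.1.2, ij.2.2⟩]

/-- The localization of a determinantal ring at an `r`-minor is the determinantal ring of minors
smaller by `r`, in the entries away from the rows and columns of the minor. -/
noncomputable def minorLocalizationEquiv :
    MinorLocalization k a b (s + Fintype.card ι) ≃ₐ[k] OffCrossQuotient k a b s :=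
  AlgEquiv.ofRingEquiv (f := RingEquiv.ofRingHom (localizationToOffCross k a b s)
    (offCrossToLocalization k a b s) (localizationToOffCross_comp k a b s)
    (offCrossToLocalization_comp k a b s)) (localizationToOffCross_algebraMap k a b s)

end Localization

/-! ### Normality. -/

section Normality

theorem ne_zero_of_nontrivial_away {R : Type*} [CommRing R] (x : R)
    [h : Nontrivial (Localization.Away x)] : x ≠ 0 := by
  intro hx
  have := IsLocalization.Away.algebraMap_isUnit (S := Localization.Away x) x
  rw [(congrArg (algebraMap R (Localization.Away x)) hx).trans (map_zero _)] at this
  exact not_isUnit_zero this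

open Polynomial in
/-- If inverting a nonzero element that generates a radical ideal produces an integrally closed
ring, then the ring itself is integrally closed. -/
theorem IsIntegrallyClosed.of_localization_away {R : Type*} [CommRing R] [IsDomain R] {x : R}
    (hx : x ≠ 0) (hrad : (Ideal.span {x}).IsRadical)
    (hint : IsIntegrallyClosed (Localization.Away x)) : IsIntegrallyClosed R := by
  have hxu : IsUnit (algebraMap R (FractionRing R) x) := by simpa using hx
  let : Algebra (Localization.Away x) (FractionRing R) :=
    (IsLocalization.Away.lift x hxu).toAlgebra
  have : IsScalarTower R (Localization.Away x) (FractionRing R) :=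
    IsScalarTower.of_algebraMap_eq fun y => (IsLocalization.Away.lift_eq x hxu y).symm
  have : IsFractionRing (Localization.Away x) (FractionRing R) :=
    IsFractionRing.isFractionRing_of_isDomain_of_isLocalization (Submonoid.powers x) _ _
  rw [isIntegrallyClosed_iff (FractionRing R)]
  intro z hz
  obtain ⟨w, hw⟩ := (isIntegrallyClosed_iff (R := Localization.Away x) (FractionRing R)).mp hint
    hz.tower_top
  obtain ⟨n, hn⟩ : ∃ n, ∃ a : R, algebraMap R (FractionRing R) a =
      algebraMap R (FractionRing R) x ^ n * z := by
    obtain ⟨n, a, ha⟩ := IsLocalization.Away.surj x w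
    refine ⟨n, a, ?_⟩
    have := congrArg (algebraMap (Localization.Away x) (FractionRing R)) ha
    rw [map_mul, map_pow, ← IsScalarTower.algebraMap_apply, ← IsScalarTower.algebraMap_apply,
      hw] at this
    rw [← this, mul_comm]
  induction n with
  | zero => simpa using hn
  | succ n ih =>
    obtain ⟨a, ha⟩ := hn
    obtain ⟨p, hp, hpz⟩ := hz
    -- Scaling the roots by x^(n+1) makes every coefficient below the leading one divisible by x. So
    -- a power of a = x^(n+1) z lies in (x), hence a does, and the exponent of x drops by one.
    have h1 : (p.scaleRoots (x ^ (n + 1))).eval a = 0 := by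
      have := scaleRoots_aeval_eq_zero (p := p) (a := z) (r := x ^ (n + 1)) hpz
      rw [map_pow, ← ha, aeval_algebraMap_apply] at this
      simpa using this
    have h2 : Ideal.Quotient.mk (Ideal.span {x}) a ^ p.natDegree = 0 := by
      have h3 := congrArg (Ideal.Quotient.mk (Ideal.span {x})) h1
      have hx0 : Ideal.Quotient.mk (Ideal.span {x}) x = 0 :=
        Ideal.Quotient.eq_zero_iff_mem.mpr (Ideal.mem_span_singleton_self x)
      rw [map_zero, eval_eq_sum_range' (n := p.natDegree + 1) (by simp),
        Finset.sum_range_succ, map_add, map_sum, Finset.sum_eq_zero, zero_add] at h3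
      · simpa [hp.leadingCoeff] using h3
      · intro i hi
        rw [Finset.mem_range] at hi
        simp [hx0, show p.natDegree - i ≠ 0 by omega]
    rw [← map_pow, Ideal.Quotient.eq_zero_iff_mem] at h2
    obtain ⟨a', rfl⟩ := Ideal.mem_span_singleton'.mp (hrad ⟨_, h2⟩)
    refine ih ⟨a', mul_left_cancel₀ hxu.ne_zero ?_⟩
    rw [map_mul] at ha
    linear_combination ha

open MvPolynomial in
theorem MvPolynomial.isIntegrallyClosed_of_finite {k : Type*} [CommRing k] [IsDomain k]
    [IsIntegrallyClosed k] (σ : Type*) [Finite σ] : IsIntegrallyClosed (MvPolynomial σ k) := by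
  induction σ using Finite.induction_empty_option with
  | of_equiv e h => exact IsIntegrallyClosed.of_equiv (renameEquiv k e).toRingEquiv
  | h_empty => exact IsIntegrallyClosed.of_equiv (isEmptyRingEquiv k _).symm
  | h_option h => exact IsIntegrallyClosed.of_equiv (optionEquivLeft k _).symm.toRingEquiv

open Matrix

theorem minorsIdeal_submatrix_of_surjective {A : Type*} [CommRing A] {α β α' β' : Type*}
    (M : Matrix α β A) {e : α' → α} {f : β' → β} (he : e.Surjective) (hf : f.Surjective) (s : ℕ) :
    minorsIdeal (M.submatrix e f) s = minorsIdeal M s := by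
  refine le_antisymm (minorsIdeal_le_iff.mpr fun a b => Ideal.subset_span ⟨_, _, rfl⟩)
    (minorsIdeal_le_iff.mpr fun a b => Ideal.subset_span
      ⟨Function.surjInv he ∘ a, Function.surjInv hf ∘ b, ?_⟩)
  congr 1
  ext i j
  simp [Function.surjInv_eq]

/-- Determinantal rings are invariant under relabeling of the rows and columns. -/
noncomputable def minorQuotientCongr (k : Type*) [CommRing k] {α β α' β' : Type*} (e : α ≃ α')
    (f : β ≃ β') (s : ℕ) : MinorQuotient k α β s ≃+* MinorQuotient k α' β' s :=
  Ideal.quotientEquiv _ _ (MvPolynomial.renameEquiv k (e.prodCongr f)).toRingEquiv (by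
    have h : (mvPolynomialX α β k).map (MvPolynomial.renameEquiv k (e.prodCongr f)).toRingEquiv =
        (mvPolynomialX α' β' k).submatrix e f := by
      ext i j
      simp
    rw [← minorsIdeal_submatrix_of_surjective (mvPolynomialX α' β' k) e.surjective f.surjective,
      ← h]
    exact (map_minorsIdeal _ _ _).symm)

/-- The quotient of a polynomial ring by the ideal of `1`-minors. -/
noncomputable def minorQuotientOneEquiv (k : Type*) [CommRing k] (α β : Type*) :
    MinorQuotient k α β 1 ≃ₐ[k] k :=
  AlgEquiv.ofAlgHom
    (Ideal.Quotient.liftₐ _ (MvPolynomial.aeval fun _ => 0) fun f hf => by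
      have : minorsIdeal (mvPolynomialX α β k) 1 ≤
          RingHom.ker (MvPolynomial.aeval fun _ => (0 : k) : MvPolynomial (α × β) k →ₐ[k] k) :=
        minorsIdeal_le_iff.mpr fun a b => by simp [RingHom.mem_ker]
      exact this hf)
    (Algebra.ofId k _) (by ext) (by
      refine Ideal.Quotient.algHom_ext _ (MvPolynomial.algHom_ext fun ij => ?_)
      have : Ideal.Quotient.mk (minorsIdeal (mvPolynomialX α β k) 1) (MvPolynomial.X ij) = 0 := by
        rw [Ideal.Quotient.eq_zero_iff_mem]
        exact Ideal.subset_span ⟨fun _ => ij.1, fun _ => ij.2, by simp⟩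
      simp [this])

theorem crossMatrix_of_mem {k : Type*} [CommRing k] {α β ι : Type*} [Fintype ι] {a : ι → α}
    {b : ι → β} {i : α} {j : β} (h : i ∈ Set.range a ∨ j ∈ Set.range b) :
    crossMatrix k a b i j = MvPolynomial.X ⟨(i, j), h⟩ := by
  rw [crossMatrix, of_apply, dif_pos h]

/-- Evaluating at the matrix with ones at the positions (a l, b l) turns the minor into 1. -/
theorem det_crossMatrix_ne_zero {k : Type*} [CommRing k] [Nontrivial k] {α β ι : Type*} [Fintype ι]
    [DecidableEq ι] {a : ι → α} {b : ι → β} (ha : a.Injective) (hb : b.Injective) :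
    ((crossMatrix k a b).submatrix a b).det ≠ 0 := by
  classical
  intro h
  have h1 := congrArg (MvPolynomial.eval fun ij : CrossIndex a b =>
    if ∃ l, ij.1 = (a l, b l) then (1 : k) else 0) h
  rw [RingHom.map_det, map_zero] at h1
  refine one_ne_zero (α := k) ((det_one (n := ι)).symm.trans (Eq.trans ?_ h1))
  congr 1
  ext i j
  rw [RingHom.mapMatrix_apply, Matrix.map_apply, submatrix_apply,
    crossMatrix_of_mem (Or.inl ⟨i, rfl⟩), MvPolynomial.eval_X, one_apply]
  congr 1
  simp only [Prod.mk.injEq, eq_iff_iff]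
  exact ⟨fun h => ⟨i, rfl, by rw [h]⟩, fun ⟨l, h, h'⟩ => (ha h).trans (hb h').symm⟩

theorem isDomain_crossRing {k : Type*} [CommRing k] [IsDomain k] {α β ι : Type*} [Fintype ι]
    [DecidableEq ι] {a : ι → α} {b : ι → β} (ha : a.Injective) (hb : b.Injective) :
    IsDomain (CrossRing k a b) :=
  IsLocalization.isDomain_localization
    (powers_le_nonZeroDivisors_of_noZeroDivisors (det_crossMatrix_ne_zero (k := k) ha hb))

theorem isIntegrallyClosed_crossRing {k : Type*} [CommRing k] [IsDomain k] [IsIntegrallyClosed k]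
    {α β ι : Type*} [Finite α] [Finite β] [Fintype ι]
    [DecidableEq ι] {a : ι → α} {b : ι → β} (ha : a.Injective) (hb : b.Injective) :
    IsIntegrallyClosed (CrossRing k a b) := by
  have := MvPolynomial.isIntegrallyClosed_of_finite (k := k) (CrossIndex a b)
  exact isIntegrallyClosed_of_isLocalization _ _
    (powers_le_nonZeroDivisors_of_noZeroDivisors (det_crossMatrix_ne_zero (k := k) ha hb))

universe u

/-- Inverting the top right entry lowers r, m and n by one but replaces the base ring by a localized
polynomial ring; this is why the base ring varies in the induction. Descent is possible because
`isRadical_minorsIdeal_sup` makes that entry generate a radical ideal. -/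
theorem isIntegrallyClosed_minorQuotient (r : ℕ) : ∀ (k : Type u) [CommRing k] [IsDomain k]
    [IsIntegrallyClosed k] (m n : ℕ), r ≤ m → r ≤ n →
    IsIntegrallyClosed (MinorQuotient k (Fin m) (Fin n) (r + 1)) := by
  induction r with
  | zero =>
    intro k _ _ _ m n _ _
    exact IsIntegrallyClosed.of_equiv (minorQuotientOneEquiv k (Fin m) (Fin n)).symm.toRingEquiv
  | succ r ih =>
    intro k _ _ _ m n hm hn
    obtain ⟨m, rfl⟩ : ∃ m', m = m' + 1 := ⟨m - 1, by omega⟩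
    obtain ⟨n, rfl⟩ : ∃ n', n = n' + 1 := ⟨n - 1, by omega⟩
    have := isPrime_minorsIdeal (k := k) (m + 1) (n + 1) (r + 1)
    let a : Fin 1 → Fin (m + 1) := fun _ => 0
    let b : Fin 1 → Fin (n + 1) := fun _ => Fin.last n
    have ha : a.Injective := Function.injective_of_subsingleton _
    have hb : b.Injective := Function.injective_of_subsingleton _
    have := isDomain_crossRing (k := k) ha hb
    have := isIntegrallyClosed_crossRing (k := k) ha hb
    have := isPrime_minorsIdeal (k := CrossRing k a b) m n r
    have := ih (CrossRing k a b) m n (by omega) (by omega)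
    have e1 : {i // i ∉ Set.range a} ≃ Fin m := Fintype.equivOfCardEq (by
      simp [a, Fintype.card_subtype_compl])
    have e2 : {j // j ∉ Set.range b} ≃ Fin n := Fintype.equivOfCardEq (by
      simp [b, Fintype.card_subtype_compl])
    let e : MinorLocalization k a b (r + 1 + 1) ≃+*
        MinorQuotient (CrossRing k a b) (Fin m) (Fin n) (r + 1) :=
      (minorLocalizationEquiv k a b (r + 1)).toRingEquiv.trans (minorQuotientCongr _ e1 e2 _)
    have hdet : ((quotientMatrix k (Fin (m + 1)) (Fin (n + 1)) (r + 1 + 1)).submatrix a b).det =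
      Ideal.Quotient.mk _ (MvPolynomial.X (0, Fin.last n)) := det_unique _
    refine IsIntegrallyClosed.of_localization_away
      (x := ((quotientMatrix k (Fin (m + 1)) (Fin (n + 1)) (r + 1 + 1)).submatrix a b).det)
      (fun h => ?_) ?_
      (IsIntegrallyClosed.of_equiv e.symm)
    · have : Nontrivial (MinorLocalization k a b (r + 1 + 1)) := e.toEquiv.nontrivial
      exact ne_zero_of_nontrivial_away _ h
    · rw [hdet, ← Set.image_singleton, ← Ideal.map_span]
      rintro f ⟨l, hl⟩
      obtain ⟨g, rfl⟩ := Ideal.Quotient.mk_surjective f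
      have h1 := isRadical_minorsIdeal_sup (k := k) m n (r + 1) (by omega)
      rw [← map_pow, ← Ideal.mem_comap, Ideal.comap_map_of_surjective' _
        Ideal.Quotient.mk_surjective, Ideal.mk_ker, sup_comm] at hl
      have h2 := h1 ⟨l, hl⟩
      rwa [sup_comm, ← Ideal.mk_ker (I := minorsIdeal (mvPolynomialX (Fin (m + 1)) (Fin (n + 1)) k)
        (r + 1 + 1)), ← Ideal.comap_map_of_surjective' _ Ideal.Quotient.mk_surjective,
        Ideal.mem_comap] at h2

end Normality

/-! ### Regularity where a (t - 1)-minor is invertible. -/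

section Regularity

open Matrix

theorem IsRegularRing.of_isLocalization {R S : Type*} [CommRing R] [CommRing S] [Algebra R S]
    [IsRegularRing R] (M : Submonoid R) [IsLocalization M S] : IsRegularRing S := by
  have := IsLocalization.isNoetherianRing M S inferInstance
  refine isRegularRing_iff.mpr fun q _ => ?_
  have := IsLocalization.isLocalization_isLocalization_atPrime_isLocalization M
    (Localization.AtPrime q) q
  exact IsRegularLocalRing.of_ringEquiv (IsLocalization.algEquiv
    (q.comap (algebraMap R S)).primeCompl (Localization.AtPrime (q.comap (algebraMap R S)))
    (Localization.AtPrime q)).toRingEquiv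

theorem isRegularLocalRing_of_away {R : Type*} [CommRing R] (x : R)
    [IsRegularRing (Localization.Away x)] (p : Ideal R) [hp : p.IsPrime] (hx : x ∉ p) :
    IsRegularLocalRing (Localization.AtPrime p) := by
  have hd : Disjoint (Submonoid.powers x : Set R) p := by
    rw [← hp.radical] at hx
    exact (Ideal.disjoint_powers_iff_notMem _ hp.isRadical).mpr (by rwa [hp.radical] at hx)
  have := IsLocalization.isPrime_of_isPrime_disjoint (Submonoid.powers x) (Localization.Away x) p
    hp hd
  have hc : ((p.map (algebraMap R (Localization.Away x))).comap
      (algebraMap R (Localization.Away x))).primeCompl = p.primeCompl := by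
    ext y
    exact not_congr (Ideal.ext_iff.mp (IsLocalization.under_map_of_isPrime_disjoint
      (Submonoid.powers x) (Localization.Away x) hp hd) y)
  have : IsLocalization p.primeCompl (Localization.AtPrime
      (p.map (algebraMap R (Localization.Away x)))) := by
    rw [← hc]
    exact IsLocalization.isLocalization_isLocalization_atPrime_isLocalization
      (Submonoid.powers x) _ _
  exact IsRegularLocalRing.of_ringEquiv (IsLocalization.algEquiv p.primeCompl
    (Localization.AtPrime (p.map (algebraMap R (Localization.Away x))))
    (Localization.AtPrime p)).toRingEquiv

variable (K : Type*) [Field K] {α β ι : Type*} [Fintype ι] [DecidableEq ι]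
  (a : ι → α) (b : ι → β)

/-- Inverting a minor of size one less than the defining minors of a determinantal ring produces a
localization of a polynomial ring. -/
noncomputable def minorLocalizationSuccEquiv :
    MinorLocalization K a b (1 + Fintype.card ι) ≃ₐ[K] CrossRing K a b :=
  (minorLocalizationEquiv K a b 1).trans
    ((minorQuotientOneEquiv (CrossRing K a b) _ _).restrictScalars K)

theorem isRegularRing_minorLocalization [Finite α] [Finite β] :
    IsRegularRing (MinorLocalization K a b (1 + Fintype.card ι)) := by
  have : IsRegularRing (CrossRing K a b) := IsRegularRing.of_isLocalization
    (Submonoid.powers ((crossMatrix K a b).submatrix a b).det)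
  exact IsRegularRing.of_ringEquiv (minorLocalizationSuccEquiv K a b).toRingEquiv.symm

end Regularity

/-! ### Strictly increasing versus arbitrary indices of minors. -/

section StrictlyIncreasing

open Matrix

/-- Minors with a repeated index vanish, and sorting distinct indices changes only the sign. -/
theorem determinantalIdeal_eq (K : Type*) [Field K] (m n t : ℕ) :
    determinantalIdeal K m n t = minorsIdeal (mvPolynomialX (Fin m) (Fin n) K) t := by
  refine le_antisymm (Ideal.span_le.mpr ?_) (minorsIdeal_le_iff.mpr fun a b => ?_)
  · rintro _ ⟨a, b, rfl⟩
    exact Ideal.subset_span ⟨a, b, rfl⟩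
  by_cases ha : a.Injective
  swap
  · obtain ⟨i, j, hij, hne⟩ : ∃ i j, a i = a j ∧ i ≠ j := by
      simpa [Function.Injective] using ha
    rw [det_zero_of_row_eq hne (by ext l; simp [hij])]
    exact zero_mem _
  by_cases hb : b.Injective
  swap
  · obtain ⟨i, j, hij, hne⟩ : ∃ i j, b i = b j ∧ i ≠ j := by
      simpa [Function.Injective] using hb
    rw [det_zero_of_column_eq hne (fun l => by simp [hij])]
    exact zero_mem _
  have sort : ∀ {N : ℕ} {c : Fin t → Fin N}, c.Injective →
      ∃ (σ : Equiv.Perm (Fin t)) (d : Fin t ↪o Fin N), c ∘ σ = d := fun {N c} hc =>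
    ⟨Tuple.sort c, OrderEmbedding.ofStrictMono _ ((Tuple.monotone_sort c).strictMono_of_injective
      (hc.comp (Tuple.sort c).injective)), rfl⟩
  obtain ⟨σ, c, hc⟩ := sort ha
  obtain ⟨τ, d, hd⟩ := sort hb
  refine det_mem_of_det_submatrix_perm_mem σ τ ?_
  rw [submatrix_submatrix, hc, hd]
  exact Ideal.subset_span ⟨c, d, rfl⟩

end StrictlyIncreasing

/-! ### Krull dimension through the transcendence degree. -/

section Dimension

open Algebra

open Matrix

/-- Incomparability gives one inequality, lying over together with going up the other. -/
theorem ringKrullDim_eq_of_isIntegral_of_faithfulSMul (R S : Type*) [CommRing R] [CommRing S]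
    [Algebra R S] [Algebra.IsIntegral R S] [FaithfulSMul R S] :
    ringKrullDim S = ringKrullDim R := by
  refine le_antisymm (Order.krullDim_le_of_strictMono
    (PrimeSpectrum.comap (algebraMap R S)) fun P Q h => Ideal.IsIntegral.comap_lt_comap h)
    (iSup_le fun l => ?_)
  obtain ⟨Q, -, hQ, hQ'⟩ := Ideal.exists_ideal_over_prime_of_isIntegral
    l.head.asIdeal (⊥ : Ideal S) (by
      rw [← RingHom.ker_eq_comap_bot, (RingHom.injective_iff_ker_eq_bot _).mp
        (FaithfulSMul.algebraMap_injective R S)]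
      exact bot_le)
  have : Q.LiesOver l.head.asIdeal := ⟨hQ'.symm⟩
  obtain ⟨L, hL, -⟩ := Ideal.exists_ltSeries_of_hasGoingUp l Q
  rw [← hL]
  exact le_iSup_of_le L le_rfl

/-- By Noether normalization both numbers are the number of variables of a polynomial ring over
which the algebra is integral. -/
theorem ringKrullDim_eq_trdeg (k A : Type*) [Field k] [CommRing A] [IsDomain A] [Algebra k A]
    [Algebra.FiniteType k A] :
    ringKrullDim A = (Cardinal.toNat (Algebra.trdeg k A) : WithBot ℕ∞) := by
  obtain ⟨s, g, hg, hg'⟩ := exists_integral_inj_algHom_of_fg k A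
  let : Algebra (MvPolynomial (Fin s) k) A := g.toRingHom.toAlgebra
  have : IsScalarTower k (MvPolynomial (Fin s) k) A := IsScalarTower.of_algHom g
  have : FaithfulSMul (MvPolynomial (Fin s) k) A :=
    (faithfulSMul_iff_algebraMap_injective _ _).mpr hg
  have : Algebra.IsIntegral (MvPolynomial (Fin s) k) A := ⟨hg'⟩
  have h := lift_trdeg_add_eq k (MvPolynomial (Fin s) k) A
  rw [trdeg_eq_zero (R := MvPolynomial (Fin s) k) (A := A), MvPolynomial.trdeg_of_isDomain] at h
  have h' := congrArg Cardinal.toNat h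
  simp at h'
  rw [ringKrullDim_eq_of_isIntegral_of_faithfulSMul (MvPolynomial (Fin s) k) A,
    MvPolynomial.ringKrullDim_of_isNoetherianRing]
  simp [← h']

theorem trdeg_localization (k A : Type*) {B : Type*} [Field k] [CommRing A] [IsDomain A]
    [Algebra k A] (M : Submonoid A) (hM : M ≤ nonZeroDivisors A) [CommRing B] [Algebra A B]
    [IsLocalization M B] [Algebra k B] [IsScalarTower k A B] :
    Cardinal.toNat (Algebra.trdeg k B) = Cardinal.toNat (Algebra.trdeg k A) := by
  have := IsLocalization.isDomain_of_le_nonZeroDivisors B hM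
  have : FaithfulSMul A B :=
    (faithfulSMul_iff_algebraMap_injective _ _).mpr (IsLocalization.injective B hM)
  have : Algebra.IsAlgebraic A B := IsLocalization.isAlgebraic B M
  have h := congrArg Cardinal.toNat (lift_trdeg_add_eq k A B)
  rw [trdeg_eq_zero (R := A) (A := B)] at h
  simpa using h.symm

theorem card_notMem_range {γ ι : Type*} [Fintype γ] [Fintype ι] {c : ι → γ} (hc : c.Injective) :
    Nat.card {i // i ∉ Set.range c} = Fintype.card γ - Fintype.card ι := by
  classical
  rw [Nat.card_eq_fintype_card, Fintype.card_subtype_compl]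
  congr 1
  exact (Fintype.card_congr (Equiv.ofInjective _ hc)).symm

theorem card_crossIndex {α β ι : Type*} [Fintype α] [Fintype β] [Fintype ι] {a : ι → α} {b : ι → β}
    (ha : a.Injective) (hb : b.Injective) :
    Nat.card (CrossIndex a b) + (Fintype.card α - Fintype.card ι) *
      (Fintype.card β - Fintype.card ι) = Fintype.card α * Fintype.card β := by
  classical
  rw [← card_notMem_range ha, ← card_notMem_range hb, ← Nat.card_prod,
    ← Nat.card_congr (Equiv.subtypeProdEquivProd (p := (· ∉ Set.range a)) (q := (· ∉ Set.range b))),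
    ← Nat.card_sum, ← Fintype.card_prod, ← Nat.card_eq_fintype_card (α := α × β)]
  exact Nat.card_congr ((Equiv.sumCongr (Equiv.refl _) (Equiv.subtypeEquivRight fun ij =>
    not_or.symm)).trans (Equiv.sumCompl _))

/-- Inverting an r-minor preserves the transcendence degree and leaves a localized polynomial ring
in the entries that share a row or a column with the minor, of which there are mn - (m - r)(n - r) =
(m + n - r) r. -/
theorem ringKrullDim_minorQuotient (K : Type*) [Field K] {m n r : ℕ} (hm : r ≤ m) (hn : r ≤ n) :
    ringKrullDim (MinorQuotient K (Fin m) (Fin n) (r + 1)) = ((m + n - r) * r : ℕ) := by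
  have hp := isPrime_minorsIdeal (k := K) m n r
  let a : Fin r → Fin m := Fin.castLE hm
  let b : Fin r → Fin n := Fin.castLE hn
  have ha : a.Injective := Fin.castLE_injective hm
  have hb : b.Injective := Fin.castLE_injective hn
  have := isDomain_crossRing (k := K) ha hb
  have e : MinorLocalization K a b (r + 1) ≃ₐ[K] CrossRing K a b := by
    have := minorLocalizationSuccEquiv K a b
    rwa [Fintype.card_fin, add_comm] at this
  have : Nontrivial (MinorLocalization K a b (r + 1)) := e.toEquiv.nontrivial
  have hd := ne_zero_of_nontrivial_away
    ((quotientMatrix K (Fin m) (Fin n) (r + 1)).submatrix a b).det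
  have h1 := trdeg_localization K (MinorQuotient K (Fin m) (Fin n) (r + 1))
    (B := MinorLocalization K a b (r + 1)) _
    (powers_le_nonZeroDivisors_of_noZeroDivisors hd)
  have h2 := trdeg_localization K (MvPolynomial (CrossIndex a b) K) (B := CrossRing K a b) _
    (powers_le_nonZeroDivisors_of_noZeroDivisors (det_crossMatrix_ne_zero (k := K) ha hb))
  have h3 := card_crossIndex ha hb
  rw [MvPolynomial.trdeg_of_isDomain] at h2
  rw [ringKrullDim_eq_trdeg K, ← h1, e.trdeg_eq, h2, Cardinal.toNat_lift]
  congr 1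
  simp only [Fintype.card_fin] at h3
  obtain ⟨m, rfl⟩ := Nat.exists_eq_add_of_le hm
  obtain ⟨n, rfl⟩ := Nat.exists_eq_add_of_le hn
  simp only [Nat.add_sub_cancel_left] at h3
  rw [show r + m + (r + n) - r = r + m + n by omega]
  change Nat.card _ = _
  linear_combination h3

end Dimension

/-! ### Failure of regularity. -/

section Nonregularity

open Matrix IsLocalRing

/-- If the `s`-minors of a matrix over a local ring are nonunits then its `(s + 1)`-minors lie in
the square of the maximal ideal. -/
theorem minorsIdeal_succ_le_maximalIdeal_sq {A : Type*} [CommRing A] [IsLocalRing A] {α β : Type*}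
    (M : Matrix α β A) {s : ℕ} (h : minorsIdeal M s ≤ maximalIdeal A) :
    minorsIdeal M (s + 1) ≤ maximalIdeal A ^ 2 := by
  induction s with
  | zero =>
    rw [minorsIdeal_zero, top_le_iff] at h
    exact absurd h (maximalIdeal.isMaximal A).ne_top
  | succ s ih =>
    by_cases hs : minorsIdeal M s ≤ maximalIdeal A
    · exact (minorsIdeal_antitone M (Nat.le_succ _)).trans (ih hs)
    -- Bordering a unit s-minor gives nonunits, so the Schur complement has all entries in the
    -- maximal ideal. As M differs from it by a product through s columns, the (s + 2)-minors of M
    -- lie in the ideal of its 2-minors.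
    obtain ⟨a, b, hab⟩ : ∃ (a : Fin s → α) (b : Fin s → β), IsUnit (M.submatrix a b).det := by
      by_contra! hu
      exact hs (minorsIdeal_le_iff.mpr fun a b => (mem_maximalIdeal _).mpr (hu a b))
    have hY : ∀ i j, (M - crossExtension M a b) i j ∈ maximalIdeal A := fun i j => by
      have h1 := h (det_submatrix_mem_minorsIdeal M (ι := Fin s ⊕ Fin 1) (by simp)
        (Sum.elim a fun _ => i) (Sum.elim b fun _ => j))
      rw [det_bordered_submatrix M a b hab, Ideal.unit_mul_mem_iff_mem _ hab] at h1
      simpa [crossExtension] using h1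
    have h2 := minorsIdeal_add_mul_le (M - crossExtension M a b)
      (M.submatrix id b * (M.submatrix a b)⁻¹) (M.submatrix a id) 2
    rw [← crossExtension, sub_add_cancel, add_comm 2 s] at h2
    exact h2.trans (minorsIdeal_le_pow hY 2)

/-- A nonzero kernel in a domain lowers the dimension, while a kernel in the square of the maximal
ideal does not lower the embedding dimension. If R were regular, then dim S ≤ edim S ≤ edim R = dim
R < dim S. Regularity of S plays no role. -/
theorem not_isRegularLocalRing_of_surjective {S R : Type*} [CommRing S] [IsDomain S] [IsLocalRing S]
    [IsNoetherianRing S] [CommRing R] {f : S →+* R} (hf : Function.Surjective f)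
    (hle : RingHom.ker f ≤ maximalIdeal S ^ 2) (hne : RingHom.ker f ≠ ⊥) :
    ¬ IsRegularLocalRing R := by
  intro hR
  have hfl : IsLocalHom f := IsLocalHom.of_surjective f hf
  obtain ⟨x, hx, hx0⟩ := Submodule.exists_mem_ne_zero_of_ne_bot hne
  have h1 := ringKrullDim_succ_le_of_surjective f hf (mem_nonZeroDivisors_of_ne_zero hx0) hx
  have hfg : (maximalIdeal R).FG := (maximalIdeal R).fg_of_isNoetherianRing
  let s := (maximalIdeal R).generators
  have hspan : Ideal.span s = maximalIdeal R := Submodule.span_generators _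
  let s' := Function.surjInv hf '' s
  have hmap : (Ideal.span s').map f = maximalIdeal R := by
    rw [Ideal.map_span, ← hspan, ← Set.image_comp]
    congr 1
    ext y
    simp [Function.surjInv_eq]
  -- Lifts of generators of the maximal ideal of R generate that of S modulo its square, so
  -- Nakayama's lemma applies.
  have h2 : maximalIdeal S = Ideal.span s' := by
    refine le_antisymm (Submodule.le_of_le_smul_of_le_jacobson_bot
      (maximalIdeal S).fg_of_isNoetherianRing (jacobson_eq_maximalIdeal ⊥ bot_ne_top).ge
      fun y hy => ?_) ?_
    · have h3 : y ∈ ((Ideal.span s').map f).comap f := by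
        rw [hmap]
        exact (mem_maximalIdeal _).mpr fun h => hy (isUnit_of_map_unit f y h)
      rw [Ideal.comap_map_of_surjective' f hf] at h3
      rw [smul_eq_mul, ← sq]
      exact sup_le_sup_left hle _ h3
    · refine (Ideal.map_le_iff_le_comap.mp hmap.le).trans fun y hy => ?_
      exact (mem_maximalIdeal _).mpr fun h => hy (h.map f)
  have h4 := ringKrullDim_le_spanFinrank_maximalIdeal S
  have h5 : (maximalIdeal S).spanFinrank ≤ s.ncard := by
    rw [h2]
    exact (Submodule.spanFinrank_span_le_ncard_of_finite
      ((Submodule.FG.finite_generators hfg).image _)).trans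
      (Set.ncard_image_le (Submodule.FG.finite_generators hfg))
  have h6 : ringKrullDim S ≤ ringKrullDim R := by
    rw [← hR.spanFinrank_maximalIdeal, ← Submodule.FG.generators_ncard hfg]
    exact h4.trans (by exact_mod_cast h5)
  have h7 := h1.trans h6
  rw [← hR.spanFinrank_maximalIdeal] at h7
  norm_cast at h7
  omega

theorem not_isRegularLocalRing_quotient_localization {S : Type*} [CommRing S] [IsDomain S]
    [IsNoetherianRing S] {I : Ideal S} (hI : I ≠ ⊥) (p : Ideal (S ⧸ I)) [p.IsPrime]
    (h : I.map (algebraMap S (Localization.AtPrime (p.comap (Ideal.Quotient.mk I)))) ≤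
      maximalIdeal _ ^ 2) : ¬ IsRegularLocalRing (Localization.AtPrime p) := by
  let P := p.comap (Ideal.Quotient.mk I)
  let f : Localization.AtPrime P →+* Localization.AtPrime p :=
    Localization.localRingHom P p (Ideal.Quotient.mk I) rfl
  have hfS (x : S) : f (algebraMap _ _ x) = algebraMap _ _ (Ideal.Quotient.mk I x) :=
    Localization.localRingHom_to_map _ _ _ _ x
  have : IsDomain (Localization.AtPrime P) := IsLocalization.isDomain_localization
    P.primeCompl_le_nonZeroDivisors
  refine not_isRegularLocalRing_of_surjective (f := f) (fun y => ?_)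
    (le_trans (fun y hy => ?_) h) ?_
  · obtain ⟨⟨y, u⟩, rfl⟩ := IsLocalization.mk'_surjective p.primeCompl y
    obtain ⟨y, rfl⟩ := Ideal.Quotient.mk_surjective y
    obtain ⟨⟨u⟩, hu⟩ := u
    refine ⟨IsLocalization.mk' _ y (⟨u, hu⟩ : P.primeCompl), ?_⟩
    exact Localization.localRingHom_mk' _ _ _ _ _ _
  · obtain ⟨y, u, rfl⟩ := IsLocalization.exists_mk'_eq P.primeCompl y
    rw [RingHom.mem_ker, Localization.localRingHom_mk', IsLocalization.mk'_eq_zero_iff] at hy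
    obtain ⟨⟨v, hv⟩, hvy⟩ := hy
    obtain ⟨v, rfl⟩ := Ideal.Quotient.mk_surjective v
    rw [← map_mul, Ideal.Quotient.eq_zero_iff_mem] at hvy
    rw [IsLocalization.mk'_eq_mul_mk'_one]
    refine Ideal.mul_mem_right _ _ ?_
    refine (Ideal.unit_mul_mem_iff_mem _ (IsLocalization.map_units (Localization.AtPrime P)
      (⟨v, hv⟩ : P.primeCompl))).mp ?_
    rw [← map_mul]
    exact Ideal.mem_map_of_mem _ hvy
  · obtain ⟨x, hx, hx0⟩ := Submodule.exists_mem_ne_zero_of_ne_bot hI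
    refine Submodule.ne_bot_iff _ |>.mpr ⟨algebraMap _ _ x, ?_, ?_⟩
    · rw [RingHom.mem_ker, hfS, Ideal.Quotient.eq_zero_iff_mem.mpr hx, map_zero]
    · rwa [Ne, IsLocalization.to_map_eq_zero_iff _ P.primeCompl_le_nonZeroDivisors]

end Nonregularity

/-! ### The singular locus and the main result. -/

open Matrix in
theorem minorsIdeal_ne_bot (K : Type*) [Field K] {m n t : ℕ} (hm : t ≤ m) (hn : t ≤ n) :
    minorsIdeal (mvPolynomialX (Fin m) (Fin n) K) t ≠ ⊥ := by
  intro h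
  have h1 := minorsIdeal_le_iff.mp h.le (Fin.castLE hm) (Fin.castLE hn)
  have h2 : (mvPolynomialX (Fin m) (Fin n) K).submatrix (Fin.castLE hm) (Fin.castLE hn) =
      (MvPolynomial.rename (Prod.map (Fin.castLE hm) (Fin.castLE hn))).mapMatrix
        (mvPolynomialX (Fin t) (Fin t) K) := by
    ext i j
    simp
  rw [Ideal.mem_bot, h2, ← AlgHom.map_det] at h1
  exact det_mvPolynomialX_ne_zero (Fin t) K (MvPolynomial.rename_injective _
    ((Fin.castLE_injective hm).prodMap (Fin.castLE_injective hn)) (h1.trans (map_zero _).symm))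

/-- If p omits some r-minor, then its local ring is a localization of the regular ring obtained by
inverting that minor. If p contains all of them, the (r + 1)-minors lie in the square of the maximal
ideal upstairs. -/
theorem singularLocus_minorQuotient (K : Type*) [Field K] {m n r : ℕ} (hm : r + 1 ≤ m)
    (hn : r + 1 ≤ n) : singularLocus (MinorQuotient K (Fin m) (Fin n) (r + 1)) =
      PrimeSpectrum.zeroLocus ((minorsIdeal (Matrix.mvPolynomialX (Fin m) (Fin n) K) r).map
        (Ideal.Quotient.mk (minorsIdeal (Matrix.mvPolynomialX (Fin m) (Fin n) K) (r + 1)))) := by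
  ext p
  rw [PrimeSpectrum.mem_zeroLocus, SetLike.coe_subset_coe, Ideal.map_le_iff_le_comap]
  refine ⟨fun hp => ?_, fun hp => ?_⟩
  · by_contra h
    obtain ⟨a, b, hab⟩ : ∃ (a : Fin r → Fin m) (b : Fin r → Fin n),
        ((quotientMatrix K (Fin m) (Fin n) (r + 1)).submatrix a b).det ∉ p.asIdeal := by
      by_contra! hab
      refine h (minorsIdeal_le_iff.mpr fun a b => ?_)
      have h1 := hab a b
      rwa [quotientMatrix, Matrix.submatrix_map, ← RingHom.mapMatrix_apply, ← RingHom.map_det] at h1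
    have : IsRegularRing (MinorLocalization K a b (r + 1)) := by
      have := isRegularRing_minorLocalization K a b
      rwa [Fintype.card_fin, add_comm] at this
    exact hp (isRegularLocalRing_of_away _ p.asIdeal hab)
  · refine not_isRegularLocalRing_quotient_localization (minorsIdeal_ne_bot K hm hn) p.asIdeal ?_
    rw [map_minorsIdeal]
    refine minorsIdeal_succ_le_maximalIdeal_sq _ ?_
    rw [← map_minorsIdeal, ← Localization.AtPrime.map_eq_maximalIdeal]
    exact Ideal.map_mono hp

theorem theorem1p9 (K : Type*) [Field K] (m n t : ℕ) (ht : 1 ≤ t) (htmn : t ≤ min m n) :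
    IsDomain (DeterminantalRing K m n t) ∧
    IsIntegrallyClosed (DeterminantalRing K m n t) ∧
    ringKrullDim (DeterminantalRing K m n t) = (((m + n - t + 1) * (t - 1) : ℕ) : WithBot ℕ∞) ∧
    singularLocus (DeterminantalRing K m n t) =
      PrimeSpectrum.zeroLocus
        ((determinantalIdeal K m n (t - 1)).map
          (Ideal.Quotient.mk (determinantalIdeal K m n t)) :
          Set (DeterminantalRing K m n t)) := by
  obtain ⟨r, rfl⟩ : ∃ r, t = r + 1 := ⟨t - 1, by omega⟩
  rw [le_min_iff] at htmn
  have hp := isPrime_minorsIdeal (k := K) m n r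
  unfold DeterminantalRing
  rw [determinantalIdeal_eq, determinantalIdeal_eq, Nat.add_sub_cancel]
  refine ⟨inferInstance, isIntegrallyClosed_minorQuotient r K m n (by omega) (by omega), ?_,
    singularLocus_minorQuotient K htmn.1 htmn.2⟩
  rw [show m + n - (r + 1) + 1 = m + n - r by omega]
  exact ringKrullDim_minorQuotient K (by omega) (by omega)
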